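/- Let $n\ge 0$, let $X$ be a finite multiset of nonzero vectors of $\mathbb R^n$ that spans $\mathbb R^n$, and let $B_0$ be an ordered basis of $\mathbb R^n$. Put $X'=X\cup B_0$ (multiset union); subsets of $X$ and $X'$ are understood as sub-multisets, with repeated vectors distinguished. *Polynomials.* Let $\Pi=\mathbb C[t_1,\dots,t_n]$. For $p\in\Pi$ put $p(D)=p(\partial/\partial t_1,\dots,\partial/\partial t_n)$, and for a polynomial or formal power series $f$ let $\langle p,f\rangle=(p(D)f)(0)$. For $x\in\mathbb R^n$ let $p_x(t)=x\cdot t$, and let $p_Y=\prod_{y\in Y}p_y$ for a multiset $Y$ of vectors. For $\alpha\in\mathbb C^n$ let $e_\alpha$ be the power series of $t\mapsto e^{\alpha\cdot t}$. For an ideal $I\subset\Pi$, $\ker I$ is the span, in $\mathbb C[[t_1,\dots,t_n]]$, of all $e_\alpha p$ with $\alpha\in\mathbb C^n$ a common zero of $I$ and $p\in\Pi$ such that $\langle q,e_\alpha p\rangle=0$ for all $q\in I$. For a finite set $\sigma\subset\mathbb C^n$, $\Pi(\sigma)=\operatorname{span}\{f_\downarrow : f\in\operatorname{span}\{e_\alpha:\alpha\in\sigma\}\}$,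 where $f_\downarrow$ is the nonzero homogeneous component of $f$ of least degree ($0_\downarrow=0$). The set $\sigma$ is correct for a subspace $P\subset\Pi$ if $p\mapsto p|_\sigma$ is a bijection from $P$ onto $\mathbb C^\sigma$. *External bases.* Let $\mathbb I(X)$ be the set of linearly independent subsets of $X$ (including $\emptyset$). For $I\in\mathbb I(X)$ let $\mathrm{ex}(I)\subset X'$ consist of $I$ and of those $b\in B_0$ with $b\notin\operatorname{span}(I\cup\{b'\in B_0: b'\prec b\})$, where $\prec$ is the order of $B_0$; this is a basis of $\mathbb R^n$. Let $\mathbb B_+(X)=\{\mathrm{ex}(I): I\in\mathbb I(X)\}$ and $L_+(X)=\{Y\subset X': Y\cap B\ne\emptyset \text{ for all } B\in\mathbb B_+(X)\}$. *Spaces and ideals.* Let $$\mathcal P_+(X)=\operatorname{span}\{p_Y:Y\subset X\},\qquad \mathcal D_+(X)=\{f\in\Pi: p_Y(D)f=0\ \text{ for all } Y\in L_+(X)\},$$ let $\mathcal J_+(X)$ be the ideal generated by $\{p_Y:Y\in L_+(X)\}$, and let $\mathcal I_+(X)$ be the ideal generated by all $p_{\eta}^{m(H)+1}$, where $H$ runs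 over the $(n-1)$-dimensional subspaces of $\mathbb R^n$ spanned by $X\cap H$, $\eta$ is a nonzero normal of $H$, and $m(H)=\#(X\setminus H)$. *Vertices.* For $\lambda\in\mathbb R^{X'}$ let $H_{x,\lambda}=\{t\in\mathbb R^n: x\cdot t=\lambda_x\}$, $x\in X'$. Call $\lambda$ generic if no $n+1$ of these hyperplanes (indexed by distinct members of $X'$) have a common point. Let $V_+(X,\lambda)\subset\mathbb R^n\subset\mathbb C^n$ be the set of the points $v_B$, $B\in\mathbb B_+(X)$, where $v_B$ is the common point of the $H_{x,\lambda}$, $x\in B$. **Theorem.** 1. $\dim\mathcal P_+(X)=\dim\mathcal D_+(X)=\#\mathbb I(X)$. 2. The map $p\mapsto\langle p,\cdot\rangle$ is a bijection from $\mathcal D_+(X)$ onto the dual space $\mathcal P_+(X)'$. 3. $\mathcal D_+(X)=\Pi(V_+(X,\lambda))$ for every generic $\lambda$, and $\mathcal D_+(X)=\ker\mathcal J_+(X)$. 4. For every generic $\lambda$, the set $V_+(X,\lambda)$ is correct for $\mathcal D_+(X)$ and for $\mathcal P_+(X)$. 5. $\mathcal P_+(X)=\ker\mathcal I_+(X)$.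 6. $\Pi=\mathcal P_+(X)\oplus\mathcal J_+(X)$. -/

import Mathlib

/-!
Contraction of a vector `x` of `X` is realized on polynomials by the substitution
`t ↦ t - (x ⋅ t) w` with `w ⋅ x = 1`: it takes `p_y` to the linear form of the projection of `y`
along `x`, and its kernel is the ideal `(p_x)`. It maps `P₊(X)` onto `P₊` of the contraction, and
the kernel of this map is `p_x P₊(X \ x)`. Induction on `X` therefore identifies `P₊(X)` with the
kernel of its power ideal, and the same recursion, which the independent subsets satisfy as well,
gives `dim P₊(X) = #𝕀(X)`.

Greedy extension of the complement of `Y` by `B₀` shows that `P₊ + J₊` is closed under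
multiplication by linear forms, so `P₊ + J₊ = Π` and `D₊`, the orthogonal complement of `J₊`, pairs
injectively with `P₊`; in particular `dim D₊ ≤ #𝕀(X)`. For the opposite inequality, `p_Y` with `Y`
long is the leading form of `∏ (p_y - λ_y)`, `y ∈ Y`, which vanishes on the vertices, so
`Π(V₊) ⊆ D₊`. The vertices of a generic arrangement correspond bijectively to independent subsets,
and `dim Π(σ) = #σ` for every finite conjugation-stable `σ`. All the inequalities are thus
equalities, which is the content of the theorem.
-/

namespace Zonotopal

noncomputable section

/-! ## Polynomials, power series, differential operators -/

/-- The space of complex polynomials in `n` variables. -/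
abbrev Poly (n : ℕ) : Type := MvPolynomial (Fin n) ℂ

/-- Formal power series in `n` variables over the complex numbers. -/
abbrev Series (n : ℕ) : Type := MvPowerSeries (Fin n) ℂ

/-- The inclusion of polynomials into formal power series, as a linear map. -/
def toSeries (n : ℕ) : Poly n →ₗ[ℂ] Series n where
  toFun p := (p : MvPowerSeries (Fin n) ℂ)
  map_add' p q := MvPolynomial.coe_add p q
  map_smul' c p := MvPolynomial.coe_smul p c

/-- `D^m`, that is `D_1 ^ m_1 ⋯ D_n ^ m_n`, acting on formal power series. -/
def monomialDiff {n : ℕ} (m : Fin n →₀ ℕ) : Module.End ℂ (Series n) :=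
  ((List.finRange n).map fun i =>
    ((MvPowerSeries.pderiv ℂ i : Derivation ℂ (Series n) (Series n)) :
      Module.End ℂ (Series n)) ^ m i).prod

/-- The differential operator `p(D)` acting on formal power series, linearly in `p`:
the monomial `t^m` acts as `D^m`. -/
def diffOp (n : ℕ) : Poly n →ₗ[ℂ] Module.End ℂ (Series n) :=
  (MvPolynomial.basisMonomials (Fin n) ℂ).constr ℂ monomialDiff

/-- The pairing `⟨p, f⟩ = (p(D) f)(0)` of a polynomial `p` with a formal power series `f`. -/
def pairing {n : ℕ} (p : Poly n) : Series n →ₗ[ℂ] ℂ :=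
  MvPowerSeries.coeff (R := ℂ) (0 : Fin n →₀ ℕ) ∘ₗ diffOp n p

/-- The pairing of two polynomial subspaces, as a map from `D` to the dual of `P`:
it sends `p` to the functional `f ↦ ⟨p, f⟩`. -/
def pairingMap {n : ℕ} (D P : Submodule ℂ (Poly n)) (p : D) : Module.Dual ℂ P :=
  pairing (p : Poly n) ∘ₗ toSeries n ∘ₗ P.subtype

/-- The power series of the exponential `t ↦ exp (α ⋅ t)`. -/
def expSeries {n : ℕ} (α : Fin n → ℂ) : Series n :=
  fun m => ∏ i, α i ^ m i / ((m i).factorial : ℂ)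

/-- The nonzero homogeneous part of least degree of a power series, and `0` for the series `0`. -/
def leastTerm {n : ℕ} (f : Series n) : Poly n :=
  ∑ m ∈ Finset.finsuppAntidiag Finset.univ f.order.toNat,
    MvPolynomial.monomial m (MvPowerSeries.coeff m f)

/-- The exponential space of a point set. -/
def expSpace {n : ℕ} (σ : Set (Fin n → ℂ)) : Submodule ℂ (Series n) :=
  Submodule.span ℂ (expSeries '' σ)

/-- The least space `Π(σ)` of a point set. -/
def leastSpace {n : ℕ} (σ : Set (Fin n → ℂ)) : Submodule ℂ (Poly n) :=
  Submodule.span ℂ (leastTerm '' (expSpace σ : Set (Series n)))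

/-- A point set is correct for a polynomial space if restriction to the points is a bijection
from the space onto all complex functions on the point set. -/
def IsCorrect {n : ℕ} (σ : Set (Fin n → ℂ)) (P : Submodule ℂ (Poly n)) : Prop :=
  Function.Bijective fun (p : P) (α : σ) => MvPolynomial.eval (α : Fin n → ℂ) (p : Poly n)

/-- The kernel of an ideal: the span of all exponential polynomials `e_α p`, with `α` in the
variety of the ideal and `p` a polynomial, that are orthogonal to the ideal. -/
def idealKer {n : ℕ} (I : Ideal (Poly n)) : Submodule ℂ (Series n) :=
  Submodule.span ℂ {g | ∃ α : Fin n → ℂ, (∀ q ∈ I, MvPolynomial.eval α q = 0) ∧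
    ∃ p : Poly n, g = expSeries α * toSeries n p ∧ ∀ q ∈ I, pairing q g = 0}

/-! ## Products of linear forms -/

/-- The linear form `p_x : t ↦ x ⋅ t`. -/
def linForm {n : ℕ} (x : Fin n → ℝ) : Poly n :=
  ∑ i, MvPolynomial.C (x i : ℂ) * MvPolynomial.X i

/-- The product `p_Y` of the linear forms of the members of the subfamily `Y` of `X`. -/
def prodForm {n : ℕ} {ι : Type*} (X : ι → Fin n → ℝ) (Y : Finset ι) : Poly n :=
  ∏ y ∈ Y, linForm (X y)

/-! ## Independent subsets and external bases

A finite multiset of vectors is a family `X : ι → Fin n → ℝ` with `ι` finite; its (multi)subsets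
are the finite subsets of `ι`. -/

/-- The independent subsets of `X`. -/
def indepSets {n : ℕ} {ι : Type*} (X : ι → Fin n → ℝ) : Set (Finset ι) :=
  {I | LinearIndependent ℝ fun i : I => X i}

/-- The multiset `X' = X ∪ B₀`. The ordered basis `B₀` is ordered by its index set. -/
def augmented {n : ℕ} {ι : Type*} (X : ι → Fin n → ℝ)
    (B₀ : Module.Basis (Fin n) ℝ (Fin n → ℝ)) : ι ⊕ Fin n → Fin n → ℝ :=
  Sum.elim X B₀

open Classical in
/-- The greedy completion `ex(I)` of `I` by elements of `B₀`. -/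
def greedyExt {n : ℕ} {ι : Type*} (X : ι → Fin n → ℝ)
    (B₀ : Module.Basis (Fin n) ℝ (Fin n → ℝ)) (I : Finset ι) : Finset (ι ⊕ Fin n) :=
  I.disjSum (Finset.univ.filter fun k =>
    B₀ k ∉ Submodule.span ℝ (X '' (I : Set ι) ∪ B₀ '' {j | j < k}))

/-- The external bases of `X`, as subsets of `X'`. -/
def externalBases {n : ℕ} {ι : Type*} (X : ι → Fin n → ℝ)
    (B₀ : Module.Basis (Fin n) ℝ (Fin n → ℝ)) : Set (Finset (ι ⊕ Fin n)) :=
  greedyExt X B₀ '' indepSets X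

/-- `L_+(X)`: the subsets of `X'` that meet every external basis. -/
def externalLong {n : ℕ} {ι : Type*} (X : ι → Fin n → ℝ)
    (B₀ : Module.Basis (Fin n) ℝ (Fin n → ℝ)) : Set (Finset (ι ⊕ Fin n)) :=
  {Y | ∀ B ∈ externalBases X B₀, ∃ y ∈ Y, y ∈ B}

/-! ## The external spaces and ideals -/

/-- `P_+(X)`: the span of all `p_Y`, `Y ⊆ X`. -/
def PPlus {n : ℕ} {ι : Type*} (X : ι → Fin n → ℝ) : Submodule ℂ (Poly n) :=
  Submodule.span ℂ (Set.range (prodForm X))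

/-- `D_+(X)`: the polynomials annihilated by `p_Y(D)` for all `Y` in `L_+(X)`. -/
def DPlus {n : ℕ} {ι : Type*} (X : ι → Fin n → ℝ)
    (B₀ : Module.Basis (Fin n) ℝ (Fin n → ℝ)) : Submodule ℂ (Poly n) :=
  ⨅ Y ∈ externalLong X B₀,
    LinearMap.ker (diffOp n (prodForm (augmented X B₀) Y) ∘ₗ toSeries n)

/-- `J_+(X)`: the ideal generated by all `p_Y`, `Y` in `L_+(X)`. -/
def JPlus {n : ℕ} {ι : Type*} (X : ι → Fin n → ℝ)
    (B₀ : Module.Basis (Fin n) ℝ (Fin n → ℝ)) : Ideal (Poly n) :=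
  Ideal.span (prodForm (augmented X B₀) '' externalLong X B₀)

/-- The facet hyperplanes of `X`: the hyperplanes `H` through `0` spanned by `X ∩ H`. -/
def facetHyperplanes {n : ℕ} {ι : Type*} (X : ι → Fin n → ℝ) :
    Set (Submodule ℝ (Fin n → ℝ)) :=
  {H | Module.finrank ℝ H + 1 = n ∧
    Submodule.span ℝ (Set.range X ∩ (H : Set (Fin n → ℝ))) = H}

/-- `m(H)`: the number of members of the multiset `X` that are not in `H`. -/
def outsideCount {n : ℕ} {ι : Type*} (X : ι → Fin n → ℝ)
    (H : Submodule ℝ (Fin n → ℝ)) : ℕ :=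
  {i | X i ∉ H}.ncard

/-- `I_+(X)`: the ideal generated by the `p_η ^ (m(H) + 1)`, with `H` a facet hyperplane
and `η` a nonzero normal of `H`. -/
def IPlus {n : ℕ} {ι : Type*} (X : ι → Fin n → ℝ) : Ideal (Poly n) :=
  Ideal.span {p | ∃ H ∈ facetHyperplanes X, ∃ η : Fin n → ℝ, η ≠ 0 ∧ (∀ h ∈ H, η ⬝ᵥ h = 0) ∧
    p = linForm η ^ (outsideCount X H + 1)}

/-! ## Hyperplane arrangements -/

/-- The parameters `lam` are generic for the arrangement of the hyperplanes
`{t | X i ⋅ t = lam i}` if no `n + 1` of these hyperplanes have a common point. -/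
def IsGeneric {n : ℕ} {κ : Type*} (X : κ → Fin n → ℝ) (lam : κ → ℝ) : Prop :=
  ∀ S : Finset κ, S.card = n + 1 → ¬ ∃ v : Fin n → ℝ, ∀ y ∈ S, X y ⬝ᵥ v = lam y

/-- `V_+(X, lam)`: the vertices of the `X'`-arrangement that correspond to the external bases,
`B` corresponding to the common point of the hyperplanes of its members. They are real points,
regarded as points of complex `n`-space. -/
def externalVertices {n : ℕ} {ι : Type*} (X : ι → Fin n → ℝ)
    (B₀ : Module.Basis (Fin n) ℝ (Fin n → ℝ)) (lam : ι ⊕ Fin n → ℝ) : Set (Fin n → ℂ) :=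
  (fun (v : Fin n → ℝ) (i : Fin n) => (v i : ℂ)) ''
    {v | ∃ B ∈ externalBases X B₀, ∀ y ∈ B, augmented X B₀ y ⬝ᵥ v = lam y}

end

end Zonotopal

open Zonotopal

namespace Zonotopal

noncomputable section

open MvPolynomial

/-! ## The pairing -/

theorem list_prod_map_pow_add {M κ : Type*} [Monoid M] (l : List κ) {a : κ → M}
    (h : ∀ i j, Commute (a i) (a j)) (m m' : κ → ℕ) :
    (l.map fun i => a i ^ (m i + m' i)).prod =
      (l.map fun i => a i ^ m i).prod * (l.map fun i => a i ^ m' i).prod := by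
  induction l with
  | nil => simp
  | cons i l ih =>
    have hc : Commute (a i ^ m' i) (l.map fun i => a i ^ m i).prod := by
      refine Commute.list_prod_right _ _ fun y hy => ?_
      obtain ⟨j, -, rfl⟩ := List.mem_map.mp hy
      exact (h i j).pow_pow _ _
    simp only [List.map_cons, List.prod_cons, ih]
    rw [pow_add, mul_assoc, mul_assoc, ← mul_assoc (a i ^ m' i), hc.eq, mul_assoc]

section Pairing

variable {n : ℕ}

theorem commute_pderiv (i j : Fin n) :
    Commute ((MvPowerSeries.pderiv ℂ i : Derivation ℂ (Series n) (Series n)) :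
      Module.End ℂ (Series n)) ((MvPowerSeries.pderiv ℂ j : Derivation ℂ (Series n) (Series n)) :
      Module.End ℂ (Series n)) := by
  rcases eq_or_ne i j with rfl | hij
  · exact Commute.refl _
  refine LinearMap.ext fun f => MvPowerSeries.ext fun m => ?_
  simp only [Module.End.mul_apply, Derivation.coeFn_coe, MvPowerSeries.coeff_pderiv,
    add_right_comm m, Finsupp.add_apply, Finsupp.single_eq_of_ne hij,
    Finsupp.single_eq_of_ne hij.symm, add_zero]
  ring

theorem monomialDiff_add (m m' : Fin n →₀ ℕ) :
    monomialDiff (m + m') = monomialDiff m * monomialDiff m' :=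
  list_prod_map_pow_add _ commute_pderiv m m'

theorem diffOp_monomial (m : Fin n →₀ ℕ) (c : ℂ) :
    diffOp n (monomial m c) = c • monomialDiff m := by
  have h : (monomial m c : Poly n) = c • basisMonomials (Fin n) ℂ m := by
    simp [smul_monomial]
  rw [h, map_smul, diffOp, Module.Basis.constr_basis]

theorem diffOp_mul (p q : Poly n) : diffOp n (p * q) = diffOp n p * diffOp n q := by
  induction p using MvPolynomial.induction_on' with
  | monomial m c =>
    induction q using MvPolynomial.induction_on' with
    | monomial m' c' =>
      rw [monomial_mul, diffOp_monomial, diffOp_monomial, diffOp_monomial, monomialDiff_add,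
        smul_mul_smul_comm]
    | add q q' h h' => rw [mul_add, map_add, map_add, h, h', mul_add]
  | add p p' h h' => rw [add_mul, map_add, map_add, h, h', add_mul]

theorem diffOp_one : diffOp n 1 = 1 := by
  refine (diffOp_monomial 0 1).trans ?_
  simp [monomialDiff]

theorem diffOp_C (c : ℂ) : diffOp n (C c) = c • 1 := by
  rw [← mul_one (C c), ← smul_eq_C_mul, map_smul, diffOp_one]

theorem diffOp_X (i : Fin n) : diffOp n (X i) =
    ((MvPowerSeries.pderiv ℂ i : Derivation ℂ (Series n) (Series n)) :
      Module.End ℂ (Series n)) := by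
  rw [X, diffOp_monomial, one_smul, monomialDiff,
    List.prod_map_eq_pow_single i _ fun j hj _ => by simp [hj.symm]]
  simp [List.count_finRange]

variable (n) in
/-- The pairing `⟨p, f⟩ = (p(D) f)(0)` as a bilinear map. -/
def pairingBilin : Poly n →ₗ[ℂ] Series n →ₗ[ℂ] ℂ :=
  LinearMap.compRight ℂ (MvPowerSeries.coeff (R := ℂ) (0 : Fin n →₀ ℕ)) ∘ₗ diffOp n

@[simp]
theorem pairingBilin_apply (p : Poly n) : pairingBilin n p = pairing p := rfl

theorem pairing_mul (p q : Poly n) (f : Series n) :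
    pairing (p * q) f = pairing p (diffOp n q f) := by
  rw [pairing, diffOp_mul]
  rfl

theorem pairing_one (f : Series n) : pairing 1 f = MvPowerSeries.coeff 0 f := by
  rw [pairing, diffOp_one]
  rfl

/-- The multi-index factorial `m! = m_1! ⋯ m_n!`, which is the value of `⟨t^m, t^m⟩`. -/
def multiFactorial (m : Fin n →₀ ℕ) : ℕ := ∏ i, (m i).factorial

theorem multiFactorial_ne_zero (m : Fin n →₀ ℕ) : multiFactorial m ≠ 0 :=
  Finset.prod_ne_zero_iff.mpr fun _ _ => Nat.factorial_ne_zero _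

theorem multiFactorial_add_single (m : Fin n →₀ ℕ) (i : Fin n) :
    multiFactorial (m + Finsupp.single i 1) = (m i + 1) * multiFactorial m := by
  have h (j : Fin n) : ((m + Finsupp.single i 1 : Fin n →₀ ℕ) j).factorial =
      (if j = i then m i + 1 else 1) * (m j).factorial := by
    rcases eq_or_ne j i with rfl | hj
    · simp [Nat.factorial_succ]
    · simp [hj]
  simp only [multiFactorial, h, Finset.prod_mul_distrib, Finset.prod_ite_eq', Finset.mem_univ,
    if_true]

theorem pairing_monomial (m : Fin n →₀ ℕ) (c : ℂ) (f : Series n) :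
    pairing (monomial m c) f = c * (multiFactorial m * MvPowerSeries.coeff m f) := by
  induction hd : m.degree generalizing m c f with
  | zero =>
    obtain rfl : m = 0 := (Finsupp.degree_eq_zero_iff m).mp hd
    simp [pairing, diffOp_C, multiFactorial, monomial_zero']
  | succ d ih =>
    obtain ⟨i, hi⟩ : ∃ i, m i ≠ 0 := by
      by_contra! h
      obtain rfl : m = 0 := Finsupp.ext h
      simp at hd
    obtain ⟨m', rfl⟩ : ∃ m', m = m' + Finsupp.single i 1 :=
      ⟨m - Finsupp.single i 1, (tsub_add_cancel_of_le (by
        rw [Finsupp.single_le_iff]; omega)).symm⟩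
    have hd' : m'.degree = d := by
      rw [map_add, Finsupp.degree_single] at hd
      omega
    have hX : (monomial (m' + Finsupp.single i 1) c : Poly n) = monomial m' c * X i := by
      rw [X, monomial_mul, mul_one]
    rw [hX, pairing_mul, ih _ _ _ hd', diffOp_X, Derivation.coeFn_coe,
      MvPowerSeries.coeff_pderiv, multiFactorial_add_single]
    push_cast
    ring

theorem pairing_eq_sum (p : Poly n) (f : Series n) :
    pairing p f = ∑ m ∈ p.support, coeff m p * (multiFactorial m * MvPowerSeries.coeff m f) := by
  have h := LinearMap.congr_fun (map_sum (pairingBilin n) (fun m => monomial m (coeff m p))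
    p.support) f
  rw [← p.as_sum] at h
  simpa only [LinearMap.sum_apply, pairingBilin_apply, pairing_monomial] using h

theorem coeff_toSeries (p : Poly n) (m : Fin n →₀ ℕ) :
    MvPowerSeries.coeff m (toSeries n p) = coeff m p :=
  MvPolynomial.coeff_coe p m

theorem toSeries_injective (n : ℕ) : Function.Injective (toSeries n) :=
  MvPolynomial.coe_injective (Fin n) ℂ

theorem pairing_toSeries_comm (p q : Poly n) :
    pairing p (toSeries n q) = pairing q (toSeries n p) := by
  have h : (pairingBilin n).compl₂ (toSeries n) =
      ((pairingBilin n).compl₂ (toSeries n)).flip := by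
    refine (basisMonomials (Fin n) ℂ).ext fun m => (basisMonomials (Fin n) ℂ).ext fun m' => ?_
    simp only [coe_basisMonomials, LinearMap.flip_apply, LinearMap.compl₂_apply,
      pairingBilin_apply, pairing_monomial, coeff_toSeries, coeff_monomial]
    rcases eq_or_ne m m' with rfl | hm
    · rfl
    · simp [hm, hm.symm]
  exact LinearMap.congr_fun₂ h p q

theorem eq_zero_of_forall_pairing_monomial {f : Series n}
    (h : ∀ m, pairing (monomial m 1) f = 0) : f = 0 := by
  refine MvPowerSeries.ext fun m => ?_
  have hm := h m
  rw [pairing_monomial, one_mul] at hm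
  exact (mul_eq_zero.mp hm).resolve_left (Nat.cast_ne_zero.mpr (multiFactorial_ne_zero m))

theorem pairing_expSeries (p : Poly n) (α : Fin n → ℂ) :
    pairing p (expSeries α) = eval α p := by
  rw [pairing_eq_sum, eval_eq']
  refine Finset.sum_congr rfl fun m _ => ?_
  congr 1
  change _ * (∏ i, α i ^ m i / ((m i).factorial : ℂ)) = _
  rw [multiFactorial, Nat.cast_prod, ← Finset.prod_mul_distrib]
  refine Finset.prod_congr rfl fun i _ => mul_div_cancel₀ _ ?_
  exact Nat.cast_ne_zero.mpr (Nat.factorial_ne_zero _)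

theorem expSeries_zero : expSeries (0 : Fin n → ℂ) = 1 := by
  rw [← sub_eq_zero]
  refine eq_zero_of_forall_pairing_monomial fun m => ?_
  have h1 : (1 : Series n) = toSeries n 1 := (coe_one (σ := Fin n) (R := ℂ)).symm
  rw [map_sub, pairing_expSeries, h1, pairing_toSeries_comm, pairing_one, coeff_toSeries,
    eval_zero]
  exact sub_self _

/-- Complex conjugation of the coefficients of a polynomial, as a conjugate-linear map. It makes
`⟨conjPoly p, q⟩` a Hermitian inner product. -/
def conjPoly : Poly n →ₛₗ[starRingEnd ℂ] Poly n where
  toFun := MvPolynomial.map (starRingEnd ℂ)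
  map_add' := map_add _
  map_smul' c p := by rw [smul_eq_C_mul, map_mul, map_C, ← smul_eq_C_mul]

theorem coeff_conjPoly (p : Poly n) (m : Fin n →₀ ℕ) :
    coeff m (conjPoly p) = starRingEnd ℂ (coeff m p) :=
  coeff_map _ _ _

theorem pairing_conjPoly_self (p : Poly n) : pairing (conjPoly p) (toSeries n p) =
    ((∑ m ∈ p.support, multiFactorial m * Complex.normSq (coeff m p) : ℝ) : ℂ) := by
  have hs : (conjPoly p).support = p.support :=
    support_map_of_injective _ (starRingEnd ℂ).injective
  rw [pairing_eq_sum, hs]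
  push_cast
  refine Finset.sum_congr rfl fun m _ => ?_
  rw [Complex.normSq_eq_conj_mul_self, coeff_toSeries, coeff_conjPoly]
  ring

theorem eq_zero_of_pairing_conjPoly_self {p : Poly n}
    (h : pairing (conjPoly p) (toSeries n p) = 0) : p = 0 := by
  rw [pairing_conjPoly_self, Complex.ofReal_eq_zero, Finset.sum_eq_zero_iff_of_nonneg fun m _ =>
    mul_nonneg (Nat.cast_nonneg _) (Complex.normSq_nonneg _)] at h
  refine support_eq_empty.mp (Finset.eq_empty_of_forall_notMem fun m hm => ?_)
  rcases mul_eq_zero.mp (h m hm) with h0 | h0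
  · exact multiFactorial_ne_zero m (Nat.cast_eq_zero.mp h0)
  · exact mem_support_iff.mp hm (Complex.normSq_eq_zero.mp h0)

end Pairing

/-! ## Homogeneous components and least terms -/

section Homogeneous

variable {τ R : Type*} [CommSemiring R]

theorem coeff_eq_zero_of_totalDegree_lt_degree {p : MvPolynomial τ R} {m : τ →₀ ℕ}
    (h : p.totalDegree < m.degree) : coeff m p = 0 :=
  coeff_eq_zero_of_totalDegree_lt (by rwa [← Finsupp.degree_apply])

theorem homogeneousComponent_add_mul {p q : MvPolynomial τ R} {d e : ℕ} (hp : p.totalDegree ≤ d)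
    (hq : q.totalDegree ≤ e) : homogeneousComponent (d + e) (p * q) =
      homogeneousComponent d p * homogeneousComponent e q := by
  classical
  have hterm (a b : τ →₀ ℕ) (hab : a.degree + b.degree = d + e) : coeff a p * coeff b q =
      coeff a (homogeneousComponent d p) * coeff b (homogeneousComponent e q) := by
    rw [coeff_homogeneousComponent, coeff_homogeneousComponent]
    rcases lt_trichotomy a.degree d with h | h | h
    · rw [coeff_eq_zero_of_totalDegree_lt_degree (by omega : q.totalDegree < b.degree)]
      simp
    · rw [if_pos h, if_pos (by omega)]
    · rw [coeff_eq_zero_of_totalDegree_lt_degree (by omega : p.totalDegree < a.degree)]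
      simp
  ext m
  by_cases hm : m.degree = d + e
  · rw [coeff_homogeneousComponent, if_pos hm, coeff_mul, coeff_mul]
    refine Finset.sum_congr rfl fun ab hab => hterm _ _ ?_
    rw [← map_add, Finset.HasAntidiagonal.mem_antidiagonal.mp hab, hm]
  · rw [(homogeneousComponent_isHomogeneous _ _).coeff_eq_zero hm,
      ((homogeneousComponent_isHomogeneous d p).mul
        (homogeneousComponent_isHomogeneous e q)).coeff_eq_zero hm]

theorem homogeneousComponent_prod {κ : Type*} (s : Finset κ) {p : κ → MvPolynomial τ R}
    {d : κ → ℕ} (h : ∀ i ∈ s, (p i).totalDegree ≤ d i) :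
    homogeneousComponent (∑ i ∈ s, d i) (∏ i ∈ s, p i) =
      ∏ i ∈ s, homogeneousComponent (d i) (p i) := by
  classical
  induction s using Finset.induction_on with
  | empty => exact homogeneousComponent_eq_self (isHomogeneous_one τ R)
  | insert i s hi ih =>
    have hs : ∀ j ∈ s, (p j).totalDegree ≤ d j := fun j hj => h j (Finset.mem_insert_of_mem hj)
    rw [Finset.sum_insert hi, Finset.prod_insert hi, Finset.prod_insert hi,
      homogeneousComponent_add_mul (h i (Finset.mem_insert_self i s))
        ((totalDegree_finsetProd _ _).trans (Finset.sum_le_sum hs)), ih hs]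

theorem homogeneousComponent_totalDegree_ne_zero {p : MvPolynomial τ R} (hp : p ≠ 0) :
    homogeneousComponent p.totalDegree p ≠ 0 := by
  obtain ⟨m, hm, hmd⟩ := Finset.exists_mem_eq_sup p.support (support_nonempty.mpr hp)
    fun m => m.sum fun _ e => e
  have hdeg : m.degree = p.totalDegree := (Finsupp.degree_apply m).trans hmd.symm
  refine ne_zero_iff.mpr ⟨m, ?_⟩
  rw [coeff_homogeneousComponent, if_pos hdeg]
  exact mem_support_iff.mp hm

theorem homogeneousComponent_mem_span {G : Set (MvPolynomial τ R)}
    (hG : ∀ g ∈ G, ∃ d, g.IsHomogeneous d) {p : MvPolynomial τ R} (hp : p ∈ Submodule.span R G)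
    (k : ℕ) : homogeneousComponent k p ∈ Submodule.span R G := by
  have hle : Submodule.span R G ≤ (Submodule.span R G).comap (homogeneousComponent k) :=
    Submodule.span_le.mpr fun g hg => by
      obtain ⟨d, hd⟩ := hG g hg
      rw [SetLike.mem_coe, Submodule.mem_comap, homogeneousComponent_of_mem hd]
      split_ifs
      · exact Submodule.subset_span hg
      · exact zero_mem _
  exact hle hp

end Homogeneous

section LeastTerm

variable {n : ℕ}

theorem pairing_congr {p : Poly n} {f g : Series n}
    (h : ∀ m ∈ p.support, MvPowerSeries.coeff m f = MvPowerSeries.coeff m g) :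
    pairing p f = pairing p g := by
  rw [pairing_eq_sum, pairing_eq_sum]
  exact Finset.sum_congr rfl fun m hm => by rw [h m hm]

theorem degree_eq_of_mem_support {p : Poly n} {d : ℕ} (hp : p.IsHomogeneous d) {m : Fin n →₀ ℕ}
    (hm : m ∈ p.support) : m.degree = d := by
  by_contra h
  exact mem_support_iff.mp hm (hp.coeff_eq_zero h)

theorem pairing_eq_zero_of_isHomogeneous {p q : Poly n} {d e : ℕ} (hp : p.IsHomogeneous d)
    (hq : q.IsHomogeneous e) (h : d ≠ e) : pairing p (toSeries n q) = 0 := by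
  rw [← map_zero (pairing p)]
  refine pairing_congr fun m hm => ?_
  rw [coeff_toSeries, map_zero, hq.coeff_eq_zero]
  rwa [degree_eq_of_mem_support hp hm]

theorem pairing_homogeneousComponent {p q : Poly n} {d : ℕ} (hq : q.IsHomogeneous d) :
    pairing (homogeneousComponent d p) (toSeries n q) = pairing p (toSeries n q) := by
  rw [pairing_toSeries_comm, pairing_toSeries_comm p]
  refine pairing_congr fun m hm => ?_
  rw [coeff_toSeries, coeff_toSeries, coeff_homogeneousComponent,
    if_pos (degree_eq_of_mem_support hq hm)]

theorem coeff_leastTerm (f : Series n) (m : Fin n →₀ ℕ) :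
    coeff m (leastTerm f) = if m.degree = f.order.toNat then MvPowerSeries.coeff m f else 0 := by
  rw [leastTerm, coeff_sum]
  simp only [coeff_monomial, Finset.sum_ite_eq', Finset.mem_finsuppAntidiag,
    Finsupp.degree_eq_sum, Finset.subset_univ, and_true]

theorem leastTerm_ne_zero {f : Series n} (hf : f ≠ 0) : leastTerm f ≠ 0 := by
  obtain ⟨m, hm, hd⟩ := MvPowerSeries.exists_coeff_ne_zero_and_order
    (MvPowerSeries.ne_zero_iff_order_finite.mp hf)
  refine ne_zero_iff.mpr ⟨m, ?_⟩
  rwa [coeff_leastTerm, if_pos (by rw [← hd]; rfl)]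

theorem leastTerm_isHomogeneous (f : Series n) : (leastTerm f).IsHomogeneous f.order.toNat := by
  intro m hm
  rw [coeff_leastTerm] at hm
  rw [Pi.one_def, ← Finsupp.degree_eq_weight_one]
  by_contra h
  exact hm (if_neg h)

theorem pairing_leastTerm {p : Poly n} {f : Series n} (h : p.totalDegree ≤ f.order.toNat) :
    pairing p (toSeries n (leastTerm f)) = pairing p f := by
  refine pairing_congr fun m hm => ?_
  rw [coeff_toSeries, coeff_leastTerm]
  split_ifs with hd
  · rfl
  · have hlt : (m.degree : ℕ∞) < f.order := by
      refine lt_of_lt_of_le (Nat.cast_lt.mpr (lt_of_le_of_ne (le_trans ?_ h) hd))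
        (ENat.natCast_toNat_le_self _)
      exact (Finsupp.degree_apply m).trans_le (le_totalDegree hm)
    exact (MvPowerSeries.coeff_of_lt_order hlt).symm

theorem pairing_homogeneousComponent_leastTerm {p : Poly n} {f : Series n} {d : ℕ}
    (hd : p.totalDegree ≤ d) (h : pairing p f = 0) :
    pairing (homogeneousComponent d p) (toSeries n (leastTerm f)) = 0 := by
  have hf := leastTerm_isHomogeneous f
  rcases eq_or_ne d f.order.toNat with rfl | hne
  · rw [pairing_homogeneousComponent hf, pairing_leastTerm hd, h]
  · exact pairing_eq_zero_of_isHomogeneous (homogeneousComponent_isHomogeneous d p) hf hne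

end LeastTerm

/-! ## Least interpolation -/

section LeastInterpolation

variable {n : ℕ} {σ : Set (Fin n → ℂ)}

theorem homogeneousComponent_mem_leastSpace {p : Poly n} (hp : p ∈ leastSpace σ) (k : ℕ) :
    homogeneousComponent k p ∈ leastSpace σ :=
  homogeneousComponent_mem_span
    (Set.forall_mem_image.mpr fun f _ => ⟨_, leastTerm_isHomogeneous f⟩) hp k

theorem pairing_eq_zero_of_mem_expSpace {p : Poly n} (hp : ∀ α ∈ σ, eval α p = 0) {f : Series n}
    (hf : f ∈ expSpace σ) : pairing p f = 0 := by
  have hle : expSpace σ ≤ LinearMap.ker (pairing p) := Submodule.span_le.mpr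
    (Set.forall_mem_image.mpr fun α hα => (pairing_expSeries p α).trans (hp α hα))
  exact hle hf

theorem pairing_leastSpace_eq_zero {p : Poly n} {d : ℕ} (hd : p.totalDegree ≤ d)
    (hp : ∀ α ∈ σ, eval α p = 0) {f : Poly n} (hf : f ∈ leastSpace σ) :
    pairing (homogeneousComponent d p) (toSeries n f) = 0 := by
  have hle : leastSpace σ ≤ LinearMap.ker (pairing (homogeneousComponent d p) ∘ₗ toSeries n) :=
    Submodule.span_le.mpr (Set.forall_mem_image.mpr fun g hg =>
      pairing_homogeneousComponent_leastTerm hd (pairing_eq_zero_of_mem_expSpace hp hg))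
  exact hle hf

theorem eq_zero_of_eval_eq_zero {M : Submodule ℂ (Poly n)}
    (hM : ∀ p ∈ M, ∀ k, homogeneousComponent k p ∈ M)
    (hperp : ∀ p ∈ M, (∀ f ∈ leastSpace σ, pairing p (toSeries n f) = 0) → p = 0)
    {p : Poly n} (hp : p ∈ M) (hσ : ∀ α ∈ σ, eval α p = 0) : p = 0 := by
  by_contra h0
  exact homogeneousComponent_totalDegree_ne_zero h0
    (hperp _ (hM p hp _) fun f hf => pairing_leastSpace_eq_zero le_rfl hσ hf)

theorem linearIndependent_expSeries (σ : Set (Fin n → ℂ)) :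
    LinearIndependent ℂ fun α : σ => expSeries (α : Fin n → ℂ) := by
  refine LinearIndependent.of_comp (LinearMap.pi fun p : Poly n => pairing p) ?_
  have hinj : Function.Injective fun α : σ =>
      ((eval (α : Fin n → ℂ) : Poly n →+* ℂ) : Poly n →* ℂ) := fun α β h =>
    Subtype.ext (funext fun i => by simpa using DFunLike.congr_fun h (X i))
  have heval : (LinearMap.pi fun p : Poly n => pairing p) ∘ (fun α : σ => expSeries α.1) =
      fun α p => eval α.1 p :=
    funext fun α => funext fun p => pairing_expSeries p α
  rw [heval]
  exact (linearIndependent_monoidHom (Poly n) ℂ).comp _ hinj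

/-- Complex conjugation of the coefficients of a power series, as a conjugate-linear map. -/
def conjSeries : Series n →ₛₗ[starRingEnd ℂ] Series n where
  toFun := MvPowerSeries.map (starRingEnd ℂ)
  map_add' := map_add _
  map_smul' c f := by
    rw [MvPowerSeries.smul_eq_C_mul, map_mul, MvPowerSeries.map_C, ← MvPowerSeries.smul_eq_C_mul]

theorem coeff_conjSeries (f : Series n) (m : Fin n →₀ ℕ) :
    MvPowerSeries.coeff m (conjSeries f) = starRingEnd ℂ (MvPowerSeries.coeff m f) :=
  MvPowerSeries.coeff_map (starRingEnd ℂ) m f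

theorem conjSeries_expSeries (α : Fin n → ℂ) :
    conjSeries (expSeries α) = expSeries (star α) := by
  refine MvPowerSeries.ext fun m => ?_
  rw [coeff_conjSeries]
  change starRingEnd ℂ (∏ i, α i ^ m i / ((m i).factorial : ℂ)) =
    ∏ i, star α i ^ m i / ((m i).factorial : ℂ)
  simp [map_prod]

theorem order_conjSeries (f : Series n) : (conjSeries f).order = f.order := by
  refine le_antisymm ?_ (MvPowerSeries.le_order_map (starRingEnd ℂ))
  refine (MvPowerSeries.le_order_map (starRingEnd ℂ)).trans_eq ?_
  congr 1
  exact MvPowerSeries.ext fun m => by simp [conjSeries]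

theorem leastTerm_conjSeries (f : Series n) :
    leastTerm (conjSeries f) = conjPoly (leastTerm f) := by
  ext m
  rw [coeff_conjPoly, coeff_leastTerm, coeff_leastTerm, order_conjSeries, coeff_conjSeries]
  split_ifs
  · rfl
  · exact (map_zero _).symm

theorem conjPoly_mem_leastSpace (hσ : ∀ α ∈ σ, star α ∈ σ) {p : Poly n}
    (hp : p ∈ leastSpace σ) : conjPoly p ∈ leastSpace σ := by
  have hexp : expSpace σ ≤ (expSpace σ).comap conjSeries :=
    Submodule.span_le.mpr (Set.forall_mem_image.mpr fun α hα =>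
      Submodule.subset_span ⟨star α, hσ α hα, (conjSeries_expSeries α).symm⟩)
  have hleast : leastSpace σ ≤ (leastSpace σ).comap conjPoly :=
    Submodule.span_le.mpr (Set.forall_mem_image.mpr fun f hf =>
      Submodule.subset_span ⟨conjSeries f, hexp hf, leastTerm_conjSeries f⟩)
  exact hleast hp

theorem pairing_conjPoly_leastTerm_self (f : Series n) :
    pairing (conjPoly (leastTerm f)) f =
      pairing (conjPoly (leastTerm f)) (toSeries n (leastTerm f)) :=
  (pairing_leastTerm ((leastTerm_isHomogeneous f).map (starRingEnd ℂ)).totalDegree_le).symm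

variable (σ) in
/-- Restriction to `σ` of the members of a polynomial space. -/
def evalOn (M : Submodule ℂ (Poly n)) : M →ₗ[ℂ] σ → ℂ :=
  LinearMap.pi fun α => (aeval (α : Fin n → ℂ)).toLinearMap ∘ₗ M.subtype

theorem evalOn_injective {M : Submodule ℂ (Poly n)}
    (h : ∀ p ∈ M, (∀ α ∈ σ, eval α p = 0) → p = 0) : Function.Injective (evalOn σ M) :=
  LinearMap.ker_eq_bot.mp (LinearMap.ker_eq_bot'.mpr fun p hp =>
    Subtype.ext (h p p.2 fun α hα => congrFun hp ⟨α, hα⟩))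

theorem isCorrect_of_finrank_eq_card [Finite σ] {M : Submodule ℂ (Poly n)}
    (hinj : ∀ p ∈ M, (∀ α ∈ σ, eval α p = 0) → p = 0)
    (hrank : Module.finrank ℂ M = Nat.card σ) : IsCorrect σ M := by
  have := Fintype.ofFinite σ
  have hE := evalOn_injective hinj
  have := Module.Finite.of_injective _ hE
  refine ⟨hE, (LinearMap.injective_iff_surjective_of_finrank_eq_finrank ?_).mp hE⟩
  rw [hrank, Module.finrank_fintype_fun_eq_card, Nat.card_eq_fintype_card]

theorem eq_zero_of_mem_leastSpace (hσ : ∀ α ∈ σ, star α ∈ σ) {p : Poly n}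
    (hp : p ∈ leastSpace σ) (h : ∀ α ∈ σ, eval α p = 0) : p = 0 :=
  eq_zero_of_eval_eq_zero (fun _ => homogeneousComponent_mem_leastSpace)
    (fun q hq hperp => eq_zero_of_pairing_conjPoly_self (by
      rw [pairing_toSeries_comm]
      exact hperp _ (conjPoly_mem_leastSpace hσ hq))) hp h

theorem finrank_leastSpace [Finite σ] (hσ : ∀ α ∈ σ, star α ∈ σ) :
    Module.finrank ℂ (leastSpace σ) = Nat.card σ := by
  have := Fintype.ofFinite σ
  have hE := evalOn_injective fun p hp => eq_zero_of_mem_leastSpace hσ hp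
  have := Module.Finite.of_injective _ hE
  let T : Series n →ₗ[ℂ] Module.Dual ℂ (leastSpace σ) :=
    ((pairingBilin n).domRestrict (leastSpace σ)).flip
  have hT : LinearIndependent ℂ fun α : σ => T (expSeries (α : Fin n → ℂ)) := by
    refine (linearIndependent_expSeries σ).map (f := T) (Submodule.disjoint_def.mpr ?_)
    rw [← Set.image_eq_range]
    intro f hf hTf
    by_contra h0
    refine leastTerm_ne_zero h0 (eq_zero_of_pairing_conjPoly_self ?_)
    rw [← pairing_conjPoly_leastTerm_self]
    exact LinearMap.congr_fun hTf ⟨conjPoly (leastTerm f),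
      conjPoly_mem_leastSpace hσ (Submodule.subset_span ⟨f, hf, rfl⟩)⟩
  rw [Nat.card_eq_fintype_card]
  refine le_antisymm ?_ ?_
  · exact (LinearMap.finrank_le_finrank_of_injective hE).trans_eq
      (Module.finrank_fintype_fun_eq_card ℂ)
  · exact hT.fintype_card_le_finrank.trans_eq Subspace.dual_finrank_eq

theorem isCorrect_leastSpace [Finite σ] (hσ : ∀ α ∈ σ, star α ∈ σ) :
    IsCorrect σ (leastSpace σ) :=
  isCorrect_of_finrank_eq_card (fun _ => eq_zero_of_mem_leastSpace hσ) (finrank_leastSpace hσ)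

end LeastInterpolation

/-! ## Derivations -/

section Derivation

theorem iterate_eq_zero_of_le {F A : Type*} [Zero A] [FunLike F A A] [ZeroHomClass F A A] {D : F}
    {a : A} {i j : ℕ} (hij : i ≤ j) (h : D^[i] a = 0) : D^[j] a = 0 := by
  rw [← Nat.sub_add_cancel hij, Function.iterate_add_apply, h, iterate_map_zero]

theorem derivation_iterate_mul_of_eq_zero {R A : Type*} [CommSemiring R] [CommSemiring A]
    [Algebra R A] {D : Derivation R A A} {a : A} (ha : D a = 0) (k : ℕ) (q : A) :
    D^[k] (a * q) = a * D^[k] q := by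
  induction k with
  | zero => rfl
  | succ k ih => simp [Function.iterate_succ_apply', ih, ha]

theorem derivation_iterate_succ_mul {R A : Type*} [CommSemiring R] [CommSemiring A]
    [Algebra R A] {D : Derivation R A A} {a : A} (ha : D (D a) = 0) (k : ℕ) (q : A) :
    D^[k + 1] (a * q) = a * D^[k + 1] q + (k + 1 : A) * (D a * D^[k] q) := by
  induction k with
  | zero => simp [mul_comm q]
  | succ k ih =>
    rw [Function.iterate_succ_apply', ih]
    simp only [map_add, Derivation.leibniz, smul_eq_mul, ha, Derivation.map_natCast,
      Derivation.map_one_eq_zero, mul_zero, add_zero, Nat.cast_add, Nat.cast_one,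
      Function.iterate_succ_apply']
    ring

variable {R A : Type*} [CommRing R] [CommRing A] [IsDomain A] [CharZero A] [Algebra R A]
  {D : Derivation R A A} {a q : A}

theorem derivation_iterate_eq_zero_of_iterate_succ_mul_eq_zero (ha : D (D a) = 0) (ha' : D a ≠ 0)
    (hq : ∃ N, D^[N] q = 0) {k : ℕ} (h : D^[k + 1] (a * q) = 0) : D^[k] q = 0 := by
  obtain ⟨N, hN⟩ := hq
  -- Downward induction: each step from `j + 1` to `j` removes one factor `D`.
  refine Nat.decreasingInduction' (P := fun j => D^[j] q = 0) (fun j _ hj ih => ?_)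
    (le_max_right N k) (iterate_eq_zero_of_le (le_max_left N k) hN)
  have h1 := iterate_eq_zero_of_le (Nat.succ_le_succ hj) h
  rw [Nat.succ_eq_add_one, derivation_iterate_succ_mul ha, ih, mul_zero, zero_add] at h1
  exact (mul_eq_zero.mp ((mul_eq_zero.mp h1).resolve_left
    (Nat.cast_add_one_ne_zero j))).resolve_left ha'

end Derivation

theorem exists_derivation_iterate_eq_zero {τ R : Type*} [CommSemiring R]
    {D : Derivation R (MvPolynomial τ R) (MvPolynomial τ R)}
    (hD : ∀ i, D (D (X i)) = 0) (q : MvPolynomial τ R) : ∃ N, D^[N] q = 0 := by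
  induction q using MvPolynomial.induction_on with
  | C c => exact ⟨1, derivation_C D c⟩
  | add p q hp hq =>
    obtain ⟨N, hN⟩ := hp
    obtain ⟨M, hM⟩ := hq
    exact ⟨max N M, by
      rw [iterate_map_add, iterate_eq_zero_of_le (le_max_left _ _) hN,
        iterate_eq_zero_of_le (le_max_right _ _) hM, add_zero]⟩
  | mul_X p i hp =>
    obtain ⟨N, hN⟩ := hp
    refine ⟨N + 1, ?_⟩
    rw [mul_comm, derivation_iterate_succ_mul (hD i), iterate_eq_zero_of_le N.le_succ hN, hN]
    simp only [mul_zero, add_zero]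

theorem eq_C_of_forall_pderiv_eq_zero {τ R : Type*} [CommRing R] [IsDomain R] [CharZero R]
    {f : MvPolynomial τ R} (h : ∀ i, pderiv i f = 0) : f = C (coeff 0 f) := by
  classical
  ext m
  rw [coeff_C]
  split_ifs with hm
  · rw [hm]
  obtain ⟨i, hi⟩ : ∃ i, m i ≠ 0 := by
    by_contra! h'
    exact hm (Finsupp.ext h').symm
  have h1 := congrArg (coeff (m - Finsupp.single i 1)) (h i)
  rw [coeff_pderiv, tsub_add_cancel_of_le
    (Finsupp.single_le_iff.mpr (Nat.one_le_iff_ne_zero.mpr hi)), coeff_zero] at h1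
  exact (mul_eq_zero.mp h1).resolve_right (Nat.cast_add_one_ne_zero _)

/-! ## Linear forms and directional derivatives -/

section LinearForms

variable {n : ℕ}

/-- The map `x ↦ p_x` as a real linear map, used to extend membership of linear forms in a
subspace from a family of vectors to its span. -/
def linFormMap (n : ℕ) : (Fin n → ℝ) →ₗ[ℝ] Poly n where
  toFun := linForm
  map_add' x y := by simp [linForm, add_mul, Finset.sum_add_distrib]
  map_smul' c x := by
    rw [linForm, linForm, Finset.smul_sum]
    refine Finset.sum_congr rfl fun i _ => ?_
    rw [RingHom.id_apply, Pi.smul_apply, smul_eq_mul, Complex.ofReal_mul, map_mul, mul_assoc,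
      C_mul', Complex.coe_smul]

theorem linFormMap_apply (x : Fin n → ℝ) : linFormMap n x = linForm x := rfl

theorem linForm_zero : linForm (0 : Fin n → ℝ) = 0 := map_zero (linFormMap n)

theorem linForm_single (i : Fin n) : linForm (Pi.single i 1) = (X i : Poly n) := by
  rw [linForm, Finset.sum_eq_single i (fun j _ hj => by simp [hj]) (by simp)]
  simp

theorem isHomogeneous_linForm (x : Fin n → ℝ) : (linForm x).IsHomogeneous 1 :=
  IsHomogeneous.sum _ _ _ fun i _ => (isHomogeneous_X ℂ i).C_mul _

/-- The derivative of polynomials in the direction `η`. -/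
def dirDeriv (η : Fin n → ℝ) : Derivation ℂ (Poly n) (Poly n) :=
  ∑ i, (η i : ℂ) • pderiv i

theorem dirDeriv_apply (η : Fin n → ℝ) (f : Poly n) :
    dirDeriv η f = ∑ i, (η i : ℂ) • pderiv i f := by
  have h := congrFun (map_sum (Derivation.coeFnAddMonoidHom (R := ℂ) (A := Poly n) (M := Poly n))
    (fun i => (η i : ℂ) • pderiv i) Finset.univ) f
  rwa [Finset.sum_apply] at h

theorem dirDeriv_X (η : Fin n → ℝ) (i : Fin n) : dirDeriv η (X i) = C (η i : ℂ) := by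
  simp [dirDeriv_apply, pderiv_X, Pi.single_apply, smul_eq_C_mul]

theorem dirDeriv_single (i : Fin n) (f : Poly n) :
    dirDeriv (Pi.single i 1) f = pderiv i f := by
  rw [dirDeriv_apply, Finset.sum_eq_single i (fun j _ hj => by simp [hj]) (by simp)]
  simp

theorem dirDeriv_sub_smul (η η₀ : Fin n → ℝ) (c : ℝ) (f : Poly n) :
    dirDeriv (η - c • η₀) f = dirDeriv η f - (c : ℂ) • dirDeriv η₀ f := by
  simp only [dirDeriv_apply, Finset.smul_sum, ← Finset.sum_sub_distrib, smul_smul, ← sub_smul,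
    Pi.sub_apply, Pi.smul_apply, smul_eq_mul, Complex.ofReal_sub, Complex.ofReal_mul]

theorem dirDeriv_commute (η η₀ : Fin n → ℝ) :
    Function.Commute (dirDeriv η) (dirDeriv η₀) := fun f => by
  have h : ⁅dirDeriv η, dirDeriv η₀⁆ = 0 :=
    derivation_ext fun i => by simp [Derivation.commutator_apply, dirDeriv_X]
  rw [← sub_eq_zero, ← Derivation.commutator_apply, h, Derivation.zero_apply]

theorem dirDeriv_dirDeriv_X (η : Fin n → ℝ) (i : Fin n) : dirDeriv η (dirDeriv η (X i)) = 0 := by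
  rw [dirDeriv_X, derivation_C]

theorem dirDeriv_linForm (η x : Fin n → ℝ) :
    dirDeriv η (linForm x) = C ((η ⬝ᵥ x : ℝ) : ℂ) := by
  simp [linForm, dirDeriv_X, dotProduct, mul_comm]

theorem dirDeriv_dirDeriv_linForm (η x : Fin n → ℝ) :
    dirDeriv η (dirDeriv η (linForm x)) = 0 := by
  rw [dirDeriv_linForm, derivation_C]

theorem linForm_ne_zero {x : Fin n → ℝ} (hx : x ≠ 0) : linForm x ≠ 0 := by
  intro h
  have h1 := dirDeriv_linForm x x
  rw [h, map_zero, eq_comm, C_eq_zero, Complex.ofReal_eq_zero] at h1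
  exact hx (dotProduct_self_eq_zero.mp h1)

theorem diffOp_linForm_toSeries (η : Fin n → ℝ) (f : Poly n) :
    diffOp n (linForm η) (toSeries n f) = toSeries n (dirDeriv η f) := by
  rw [dirDeriv_apply, linForm]
  simp only [map_sum, LinearMap.sum_apply, map_smul]
  refine Finset.sum_congr rfl fun i _ => ?_
  rw [C_mul', map_smul, diffOp_X, LinearMap.smul_apply, Derivation.coeFn_coe]
  exact congrArg _ (MvPowerSeries.pderiv_coe f)

theorem diffOp_linForm_pow_toSeries (η : Fin n → ℝ) (k : ℕ) (f : Poly n) :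
    diffOp n (linForm η ^ k) (toSeries n f) = toSeries n ((dirDeriv η)^[k] f) := by
  induction k generalizing f with
  | zero => simp [diffOp_one]
  | succ k ih => rw [pow_succ, diffOp_mul, Module.End.mul_apply, diffOp_linForm_toSeries, ih,
      Function.iterate_succ_apply]

end LinearForms

/-! ## Functionals whose kernel is spanned by members of a family -/

section Flat

variable {K V W ι : Type*} [Field K] [AddCommGroup V] [Module K V] [AddCommGroup W] [Module K W]

/-- A functional is flat for the subfamily `S` of `v` if its kernel in the span of the subfamily is
spanned by members of the subfamily. It then cuts out either this span or, in the language of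
matroids, a hyperplane of the restriction to `S`; allowing the former lets deletion-contraction
arguments go through uniformly. -/
def IsFlatFunctional (v : ι → V) (S : Set ι) (f : Module.Dual K V) : Prop :=
  Submodule.span K (v '' S) ⊓ LinearMap.ker f ≤ Submodule.span K (v '' {j ∈ S | f (v j) = 0})

variable {v : ι → V} {S : Set ι} {i : ι} {f g : Module.Dual K V}

theorem span_image_sep_le_insert :
    Submodule.span K (v '' {j ∈ S | f (v j) = 0}) ≤
      Submodule.span K (v '' {j ∈ insert i S | f (v j) = 0}) :=
  Submodule.span_mono (Set.image_mono fun _ hj => ⟨Set.mem_insert_of_mem i hj.1, hj.2⟩)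

theorem IsFlatFunctional.congr (hf : IsFlatFunctional v S f) (h : ∀ j ∈ S, f (v j) = g (v j)) :
    IsFlatFunctional v S g := by
  have hfg : Set.EqOn f g (Submodule.span K (v '' S)) :=
    LinearMap.eqOn_span (Set.forall_mem_image.mpr h)
  rintro z ⟨hz, hgz⟩
  refine Submodule.span_mono (Set.image_mono fun j hj => ?_) (hf ⟨hz, (hfg hz).trans hgz⟩)
  exact ⟨hj.1, (h j hj.1).symm.trans hj.2⟩

theorem IsFlatFunctional.insert_of_mem_span (hf : IsFlatFunctional v S f)
    (hi : v i ∈ Submodule.span K (v '' S)) : IsFlatFunctional v (insert i S) f := by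
  rw [IsFlatFunctional, Set.image_insert_eq, Submodule.span_insert_eq_span hi]
  exact hf.trans span_image_sep_le_insert

theorem IsFlatFunctional.insert_of_eq_zero (hf : IsFlatFunctional v S f) (hi : f (v i) = 0) :
    IsFlatFunctional v (insert i S) f := by
  rintro z ⟨hz, hfz⟩
  rw [SetLike.mem_coe, Set.image_insert_eq, Submodule.mem_span_insert] at hz
  obtain ⟨a, s, hs, rfl⟩ := hz
  have hfs : f s = 0 := by simpa [hi] using hfz
  exact add_mem (Submodule.smul_mem _ a (Submodule.subset_span ⟨i, ⟨Or.inl rfl, hi⟩, rfl⟩))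
    (span_image_sep_le_insert (hf ⟨hs, hfs⟩))

theorem IsFlatFunctional.insert_of_ne_zero (hS : ∀ j ∈ S, f (v j) = 0) (hi : f (v i) ≠ 0) :
    IsFlatFunctional v (insert i S) f := by
  rintro z ⟨hz, hfz⟩
  rw [SetLike.mem_coe, Set.image_insert_eq, Submodule.mem_span_insert] at hz
  obtain ⟨a, s, hs, rfl⟩ := hz
  have hfs : f s = 0 :=
    LinearMap.mem_ker.mp (Submodule.span_le.mpr (Set.forall_mem_image.mpr hS) hs)
  have ha : a = 0 := by simpa [hfs, hi] using hfz
  have hsub : S ⊆ {j ∈ insert i S | f (v j) = 0} := fun j hj => ⟨Or.inr hj, hS j hj⟩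
  rw [ha, zero_smul, zero_add]
  exact Submodule.span_mono (Set.image_mono hsub) hs

theorem IsFlatFunctional.insert_of_comp {p : V →ₗ[K] W}
    (hp : LinearMap.ker p = Submodule.span K {v i}) {f : Module.Dual K W}
    (hf : IsFlatFunctional (p ∘ v) S f) : IsFlatFunctional v (insert i S) (f ∘ₗ p) := by
  have hpi : p (v i) = 0 := LinearMap.mem_ker.mp (hp ▸ Submodule.mem_span_singleton_self (v i))
  rintro z ⟨hz, hfz⟩
  have hpz : p z ∈ Submodule.span K (p ∘ v '' S) := by
    have h := Submodule.mem_map_of_mem (f := p) hz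
    rwa [Submodule.map_span, Set.image_insert_eq, Set.image_insert_eq, hpi,
      Submodule.span_insert_zero, ← Set.image_comp] at h
  have h := hf ⟨hpz, hfz⟩
  rw [Set.image_comp, ← Submodule.map_span] at h
  obtain ⟨u, hu, hup⟩ := h
  have hzu : z - u ∈ Submodule.span K {v i} := by
    rw [← hp, LinearMap.mem_ker, map_sub, hup, sub_self]
  rw [← sub_add_cancel z u]
  refine add_mem (Submodule.span_mono (Set.singleton_subset_iff.mpr ?_) hzu)
    (span_image_sep_le_insert (f := f ∘ₗ p) hu)
  exact ⟨i, ⟨Or.inl rfl, by simp [hpi]⟩, rfl⟩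

theorem isFlatFunctional_coord {κ : Type*} (b : Module.Basis κ K V) (hb : Set.range b ⊆ v '' S)
    (j : κ) : IsFlatFunctional v S (b.coord j) := by
  rintro z ⟨-, hz⟩
  rw [SetLike.mem_coe, LinearMap.mem_ker, b.coord_apply] at hz
  rw [← b.linearCombination_repr z, Finsupp.linearCombination_apply]
  refine Submodule.sum_mem _ fun k hk => Submodule.smul_mem _ _ (Submodule.subset_span ?_)
  have hkj : k ≠ j := by
    rintro rfl
    exact Finsupp.mem_support_iff.mp hk hz
  obtain ⟨i, hi, hik⟩ := hb ⟨k, rfl⟩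
  exact ⟨i, ⟨hi, by rw [hik, b.coord_apply, b.repr_self, Finsupp.single_eq_of_ne hkj.symm]⟩, hik⟩

end Flat

/-! ## Contraction of a linear form -/

section Contraction

variable {n : ℕ} {ι : Type*}

/-- The projection of `ℝ ^ n` along `x` with image orthogonal to `w`, when `w ⬝ᵥ x = 1`. -/
def projAlong (x w : Fin n → ℝ) : (Fin n → ℝ) →ₗ[ℝ] (Fin n → ℝ) :=
  LinearMap.id - (dotProductEquiv ℝ (Fin n) w).smulRight x

theorem projAlong_apply (x w y : Fin n → ℝ) : projAlong x w y = y - (w ⬝ᵥ y) • x := rfl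

theorem projAlong_dotProduct (x w η y : Fin n → ℝ) :
    projAlong w x η ⬝ᵥ y = η ⬝ᵥ projAlong x w y := by
  simp only [projAlong_apply, sub_dotProduct, dotProduct_sub, smul_dotProduct, dotProduct_smul,
    smul_eq_mul, dotProduct_comm x]
  ring

theorem ker_projAlong {x w : Fin n → ℝ} (hw : w ⬝ᵥ x = 1) :
    LinearMap.ker (projAlong x w) = Submodule.span ℝ {x} := by
  ext y
  rw [LinearMap.mem_ker, projAlong_apply, sub_eq_zero, Submodule.mem_span_singleton]
  refine ⟨fun h => ⟨_, h.symm⟩, ?_⟩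
  rintro ⟨c, rfl⟩
  rw [dotProduct_smul, hw, smul_eq_mul, mul_one]

theorem exists_dotProduct_eq_one {x : Fin n → ℝ} (hx : x ≠ 0) : ∃ w, w ⬝ᵥ x = 1 :=
  ⟨(x ⬝ᵥ x)⁻¹ • x, by
    rw [smul_dotProduct, smul_eq_mul, inv_mul_cancel₀ (mt dotProduct_self_eq_zero.mp hx)]⟩

/-- The substitution `t ↦ t - (x ⋅ t) w`, which takes `p_y` to the linear form of the projection
of `y` along `x`. -/
def shear (x w : Fin n → ℝ) : Poly n →ₐ[ℂ] Poly n :=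
  aeval fun i => X i - C (w i : ℂ) * linForm x

theorem shear_linForm (x w y : Fin n → ℝ) :
    shear x w (linForm y) = linForm (projAlong x w y) := by
  have h (a : ℝ) (z : Fin n → ℝ) : linForm (a • z) = C (a : ℂ) * linForm z := by
    simp only [linForm, Pi.smul_apply, smul_eq_mul, Complex.ofReal_mul, map_mul, mul_assoc,
      Finset.mul_sum]
  rw [projAlong_apply, ← linFormMap_apply (y - _), map_sub, linFormMap_apply, linFormMap_apply, h]
  simp only [shear, linForm, map_sum, map_mul, aeval_X, aeval_C, dotProduct, algebraMap_eq,
    Complex.ofReal_sum, Complex.ofReal_mul, mul_sub, Finset.sum_sub_distrib, Finset.sum_mul]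
  exact congrArg _ (Finset.sum_congr rfl fun i _ => by ring)

theorem shear_prodForm (v : ι → Fin n → ℝ) (x w : Fin n → ℝ) (Y : Finset ι) :
    shear x w (prodForm v Y) = prodForm (projAlong x w ∘ v) Y := by
  simp only [prodForm, map_prod, shear_linForm, Function.comp_apply]

theorem dvd_sub_algHom_apply {τ R : Type*} [CommRing R]
    {φ : MvPolynomial τ R →ₐ[R] MvPolynomial τ R} {a : MvPolynomial τ R}
    (h : ∀ i, a ∣ X i - φ (X i)) (f : MvPolynomial τ R) : a ∣ f - φ f := by
  have hφ : Ideal.Quotient.mkₐ R (Ideal.span {a}) =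
      (Ideal.Quotient.mkₐ R (Ideal.span {a})).comp φ :=
    algHom_ext fun i => Ideal.Quotient.eq.mpr (Ideal.mem_span_singleton.mpr (h i))
  exact Ideal.mem_span_singleton.mp (Ideal.Quotient.eq.mp (AlgHom.congr_fun hφ f))

theorem linForm_dvd_sub_shear (x w : Fin n → ℝ) (f : Poly n) :
    linForm x ∣ f - shear x w f :=
  dvd_sub_algHom_apply (fun i => by rw [shear, aeval_X, sub_sub_cancel]; exact dvd_mul_left _ _) f

theorem dirDeriv_shear (x w η : Fin n → ℝ) (f : Poly n) :
    dirDeriv η (shear x w f) = shear x w (dirDeriv (projAlong w x η) f) := by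
  induction f using MvPolynomial.induction_on with
  | C c => simp [shear]
  | add p q hp hq => simp only [map_add, hp, hq]
  | mul_X p i hp =>
    simp only [map_mul, Derivation.leibniz, smul_eq_mul, map_add, hp]
    congr 2
    simp [shear, dirDeriv_X, dirDeriv_linForm, projAlong_apply, dotProduct_comm x, mul_comm]

theorem dirDeriv_iterate_shear (x w η : Fin n → ℝ) (k : ℕ) (f : Poly n) :
    (dirDeriv η)^[k] (shear x w f) = shear x w ((dirDeriv (projAlong w x η))^[k] f) :=
  (Function.Semiconj.iterate_right (fun f => (dirDeriv_shear x w η f).symm) k f).symm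

end Contraction

/-! ## Spans of products of linear forms as kernels of power ideals -/

section PowerKernel

variable {n : ℕ} {ι : Type*}

/-- The span of the products `p_Y`, `Y ⊆ S`. -/
def prodSpan (v : ι → Fin n → ℝ) (S : Finset ι) : Submodule ℂ (Poly n) :=
  Submodule.span ℂ (prodForm v '' S.powerset)

/-- The number of members of the subfamily `S` of `v` that are not orthogonal to `η`. -/
def nonOrthCount (v : ι → Fin n → ℝ) (S : Finset ι) (η : Fin n → ℝ) : ℕ :=
  {y ∈ S | η ⬝ᵥ v y ≠ 0}.card

/-- The polynomials of degree at most `nonOrthCount v S η` along every direction `η` that is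
flat for the subfamily `S` of `v`. -/
def powerKer (v : ι → Fin n → ℝ) (S : Finset ι) : Submodule ℂ (Poly n) :=
  ⨅ η ∈ {η | IsFlatFunctional v (S : Set ι) (dotProductEquiv ℝ (Fin n) η)},
    LinearMap.ker ((dirDeriv η : Module.End ℂ (Poly n)) ^ (nonOrthCount v S η + 1))

variable {v : ι → Fin n → ℝ} {S : Finset ι} {i : ι} {f q : Poly n} {η : Fin n → ℝ}

theorem mem_powerKer : f ∈ powerKer v S ↔
    ∀ η, IsFlatFunctional v (S : Set ι) (dotProductEquiv ℝ (Fin n) η) →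
      (dirDeriv η)^[nonOrthCount v S η + 1] f = 0 := by
  simp [powerKer, Submodule.mem_iInf, Module.End.pow_apply]

theorem prodForm_insert [DecidableEq ι] (hi : i ∉ S) :
    prodForm v (insert i S) = linForm (v i) * prodForm v S :=
  Finset.prod_insert hi

theorem prodSpan_empty (v : ι → Fin n → ℝ) : prodSpan v ∅ = Submodule.span ℂ {1} := by
  simp [prodSpan, prodForm]

theorem prodSpan_insert [DecidableEq ι] (v : ι → Fin n → ℝ) (hi : i ∉ S) :
    prodSpan v (insert i S) =
      prodSpan v S ⊔ (prodSpan v S).map (LinearMap.mulLeft ℂ (linForm (v i))) := by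
  rw [prodSpan, prodSpan, Submodule.map_span, ← Submodule.span_union, Finset.powerset_insert,
    Finset.coe_union, Set.image_union, Finset.coe_image, Set.image_image, Set.image_image]
  congr 2
  refine Set.image_congr fun Y hY => prodForm_insert fun h => hi ?_
  exact Finset.mem_powerset.mp hY h

theorem map_shear_prodSpan (v : ι → Fin n → ℝ) (x w : Fin n → ℝ) (S : Finset ι) :
    (prodSpan v S).map (shear x w).toLinearMap = prodSpan (projAlong x w ∘ v) S := by
  rw [prodSpan, prodSpan, Submodule.map_span, Set.image_image]
  simp only [AlgHom.toLinearMap_apply, shear_prodForm]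

theorem nonOrthCount_insert_of_eq_zero [DecidableEq ι] (h : η ⬝ᵥ v i = 0) (S : Finset ι) :
    nonOrthCount v (insert i S) η = nonOrthCount v S η := by
  rw [nonOrthCount, Finset.filter_insert, if_neg (not_not.mpr h), nonOrthCount]

theorem nonOrthCount_insert_of_ne_zero [DecidableEq ι] (hi : i ∉ S) (h : η ⬝ᵥ v i ≠ 0) :
    nonOrthCount v (insert i S) η = nonOrthCount v S η + 1 := by
  rw [nonOrthCount, Finset.filter_insert, if_pos h,
    Finset.card_insert_of_notMem (fun h' => hi (Finset.mem_filter.mp h').1), nonOrthCount]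

theorem nonOrthCount_congr {v' : ι → Fin n → ℝ} {η' : Fin n → ℝ}
    (h : ∀ y ∈ S, η ⬝ᵥ v y = η' ⬝ᵥ v' y) : nonOrthCount v S η = nonOrthCount v' S η' :=
  congrArg Finset.card (Finset.filter_congr fun y hy => by rw [h y hy])

theorem nonOrthCount_mono {Y : Finset ι} (h : Y ⊆ S) : nonOrthCount v Y η ≤ nonOrthCount v S η :=
  Finset.card_le_card (Finset.filter_subset_filter _ h)

theorem dirDeriv_iterate_prodForm (v : ι → Fin n → ℝ) (η : Fin n → ℝ) (Y : Finset ι) :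
    (dirDeriv η)^[nonOrthCount v Y η + 1] (prodForm v Y) = 0 := by
  classical
  induction Y using Finset.induction_on with
  | empty => simp [prodForm, nonOrthCount]
  | insert i Y hi ih =>
    rw [prodForm_insert hi]
    by_cases h : η ⬝ᵥ v i = 0
    · have h0 : dirDeriv η (linForm (v i)) = 0 := by simp [dirDeriv_linForm, h]
      rw [nonOrthCount_insert_of_eq_zero h, derivation_iterate_mul_of_eq_zero h0, ih, mul_zero]
    · rw [nonOrthCount_insert_of_ne_zero hi h,
        derivation_iterate_succ_mul (dirDeriv_dirDeriv_linForm _ _),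
        Function.iterate_succ_apply', ih, map_zero, mul_zero, mul_zero, mul_zero, add_zero]

theorem dirDeriv_iterate_eq_zero_of_mem_prodSpan (η : Fin n → ℝ) (hf : f ∈ prodSpan v S) :
    (dirDeriv η)^[nonOrthCount v S η + 1] f = 0 := by
  have hle : prodSpan v S ≤
      LinearMap.ker ((dirDeriv η : Module.End ℂ (Poly n)) ^ (nonOrthCount v S η + 1)) := by
    refine Submodule.span_le.mpr (Set.forall_mem_image.mpr fun Y hY => ?_)
    have hcount := nonOrthCount_mono (v := v) (η := η) (Finset.mem_powerset.mp hY)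
    rw [SetLike.mem_coe, LinearMap.mem_ker, Module.End.pow_apply]
    exact iterate_eq_zero_of_le (Nat.add_le_add_right hcount 1) (dirDeriv_iterate_prodForm v η Y)
  simpa [Module.End.pow_apply] using hle hf

theorem prodSpan_le_powerKer (v : ι → Fin n → ℝ) (S : Finset ι) :
    prodSpan v S ≤ powerKer v S :=
  fun _ hf => mem_powerKer.mpr fun η _ => dirDeriv_iterate_eq_zero_of_mem_prodSpan η hf

theorem dirDeriv_iterate_eq_zero_of_linForm_mul_mem_powerKer [DecidableEq ι] (hi : i ∉ S)
    (hvi : v i ≠ 0) (hq : linForm (v i) * q ∈ powerKer v (insert i S))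
    (hη : IsFlatFunctional v (insert i S : Set ι) (dotProductEquiv ℝ (Fin n) η)) :
    (dirDeriv η)^[nonOrthCount v S η + 1] q = 0 := by
  have h := mem_powerKer.mp hq η (by rwa [Finset.coe_insert])
  by_cases h0 : η ⬝ᵥ v i = 0
  · rw [nonOrthCount_insert_of_eq_zero h0,
      derivation_iterate_mul_of_eq_zero (by simp [dirDeriv_linForm, h0])] at h
    exact (mul_eq_zero.mp h).resolve_left (linForm_ne_zero hvi)
  · rw [nonOrthCount_insert_of_ne_zero hi h0] at h
    exact derivation_iterate_eq_zero_of_iterate_succ_mul_eq_zero (dirDeriv_dirDeriv_linForm _ _)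
      (by simpa [dirDeriv_linForm] using h0)
      (exists_derivation_iterate_eq_zero (dirDeriv_dirDeriv_X η) q) h

theorem dirDeriv_iterate_sub_smul {η₀ : Fin n → ℝ} (hq : dirDeriv η₀ q = 0) (η : Fin n → ℝ) (c : ℝ)
    (k : ℕ) : (dirDeriv (η - c • η₀))^[k] q = (dirDeriv η)^[k] q := by
  have hcomm (k : ℕ) : dirDeriv η₀ ((dirDeriv η)^[k] q) = 0 := by
    rw [(dirDeriv_commute η₀ η).iterate_right k |>.eq q, hq, iterate_map_zero]
  induction k with
  | zero => simp only [Function.iterate_zero, id_eq]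
  | succ k ih => rw [Function.iterate_succ_apply', ih, dirDeriv_sub_smul, hcomm, smul_zero,
      sub_zero, Function.iterate_succ_apply']

theorem mem_powerKer_of_linForm_mul_mem_powerKer [DecidableEq ι] (hi : i ∉ S) (hvi : v i ≠ 0)
    (hq : linForm (v i) * q ∈ powerKer v (insert i S)) : q ∈ powerKer v S := by
  refine mem_powerKer.mpr fun η hη => ?_
  by_cases hspan : v i ∈ Submodule.span ℝ (v '' S)
  · exact dirDeriv_iterate_eq_zero_of_linForm_mul_mem_powerKer hi hvi hq
      (hη.insert_of_mem_span hspan)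
  obtain ⟨φ, hφi, hφ⟩ := Submodule.exists_le_ker_of_notMem hspan
  obtain ⟨η₀, rfl⟩ := (dotProductEquiv ℝ (Fin n)).surjective φ
  have hη₀i : η₀ ⬝ᵥ v i ≠ 0 := hφi
  have hη₀ (j) (hj : j ∈ S) : η₀ ⬝ᵥ v j = 0 := hφ (Submodule.subset_span ⟨j, hj, rfl⟩)
  have hq₀ : dirDeriv η₀ q = 0 := by
    have h := dirDeriv_iterate_eq_zero_of_linForm_mul_mem_powerKer hi hvi hq
      (IsFlatFunctional.insert_of_ne_zero (f := dotProductEquiv ℝ (Fin n) η₀) hη₀ hη₀i)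
    rwa [nonOrthCount_congr (η' := 0) (v' := v) (by simpa using hη₀), nonOrthCount,
      Finset.filter_false_of_mem (by simp), Finset.card_empty] at h
  -- Modulo `η₀`, which does not differentiate `q`, every `η` may be taken orthogonal to `v i`.
  set c := (η ⬝ᵥ v i) / (η₀ ⬝ᵥ v i)
  have hci : (η - c • η₀) ⬝ᵥ v i = 0 := by
    rw [sub_dotProduct, smul_dotProduct, smul_eq_mul, div_mul_cancel₀ _ hη₀i, sub_self]
  have hc (j) (hj : j ∈ S) : η ⬝ᵥ v j = (η - c • η₀) ⬝ᵥ v j := by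
    rw [sub_dotProduct, smul_dotProduct, hη₀ j hj, smul_zero, sub_zero]
  rw [← dirDeriv_iterate_sub_smul hq₀ η c, nonOrthCount_congr hc]
  exact dirDeriv_iterate_eq_zero_of_linForm_mul_mem_powerKer hi hvi hq
    ((hη.congr (g := dotProductEquiv ℝ (Fin n) (η - c • η₀)) hc).insert_of_eq_zero hci)

theorem shear_mem_powerKer [DecidableEq ι] {w : Fin n → ℝ} (hw : w ⬝ᵥ v i = 1)
    (hf : f ∈ powerKer v (insert i S)) :
    shear (v i) w f ∈ powerKer (projAlong (v i) w ∘ v) S := by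
  refine mem_powerKer.mpr fun η hη => ?_
  set η' := projAlong w (v i) η
  have hdot (y : Fin n → ℝ) : η' ⬝ᵥ y = η ⬝ᵥ projAlong (v i) w y := projAlong_dotProduct _ _ _ _
  have hflat : IsFlatFunctional v (insert i S : Set ι) (dotProductEquiv ℝ (Fin n) η') := by
    rw [show dotProductEquiv ℝ (Fin n) η' = dotProductEquiv ℝ (Fin n) η ∘ₗ projAlong (v i) w from
      LinearMap.ext hdot]
    exact hη.insert_of_comp (ker_projAlong hw)
  have hi : η' ⬝ᵥ v i = 0 := by simp [hdot, projAlong_apply, hw]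
  have h := mem_powerKer.mp hf η' (by rwa [Finset.coe_insert])
  have hcount : nonOrthCount v S η' = nonOrthCount (projAlong (v i) w ∘ v) S η :=
    nonOrthCount_congr fun y _ => hdot (v y)
  rw [nonOrthCount_insert_of_eq_zero hi, hcount] at h
  rw [dirDeriv_iterate_shear, h, map_zero]

theorem powerKer_empty_le (v : ι → Fin n → ℝ) : powerKer v ∅ ≤ prodSpan v ∅ := by
  intro f hf
  have hη (η) : dirDeriv η f = 0 := by
    have h := mem_powerKer.mp hf η (by simp [IsFlatFunctional])
    simpa [nonOrthCount] using h
  rw [eq_C_of_forall_pderiv_eq_zero fun i => (dirDeriv_single i f).symm.trans (hη _),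
    prodSpan_empty, Submodule.mem_span_singleton]
  exact ⟨_, by rw [smul_eq_C_mul, mul_one]⟩

theorem powerKer_le_prodSpan (v : ι → Fin n → ℝ) (S : Finset ι) : powerKer v S ≤ prodSpan v S := by
  classical
  induction S using Finset.induction_on generalizing v with
  | empty => exact powerKer_empty_le v
  | insert i S hi ih =>
    intro f hf
    rw [prodSpan_insert v hi]
    rcases eq_or_ne (v i) 0 with h0 | h0
    · refine Submodule.mem_sup_left (ih v (mem_powerKer.mpr fun η hη => ?_))
      have h := mem_powerKer.mp hf η
        (by rw [Finset.coe_insert]; exact hη.insert_of_mem_span (h0 ▸ zero_mem _))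
      rwa [nonOrthCount_insert_of_eq_zero (by rw [h0, dotProduct_zero])] at h
    · obtain ⟨w, hw⟩ := exists_dotProduct_eq_one h0
      obtain ⟨g, hg, hgf⟩ : shear (v i) w f ∈ (prodSpan v S).map (shear (v i) w).toLinearMap := by
        rw [map_shear_prodSpan]
        exact ih _ (shear_mem_powerKer hw hf)
      obtain ⟨q, hq⟩ : linForm (v i) ∣ f - g := by
        have h := linForm_dvd_sub_shear (v i) w (f - g)
        rwa [map_sub, ← hgf, AlgHom.toLinearMap_apply, sub_self, sub_zero] at h
      have hqS : q ∈ prodSpan v S := by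
        refine ih v (mem_powerKer_of_linForm_mul_mem_powerKer hi h0 (hq ▸ sub_mem hf ?_))
        exact prodSpan_le_powerKer v _ (prodSpan_insert v hi ▸ Submodule.mem_sup_left hg)
      rw [← add_sub_cancel g f, hq]
      exact Submodule.add_mem_sup hg ⟨q, hqS, rfl⟩

theorem powerKer_eq_prodSpan (v : ι → Fin n → ℝ) (S : Finset ι) : powerKer v S = prodSpan v S :=
  le_antisymm (powerKer_le_prodSpan v S) (prodSpan_le_powerKer v S)

end PowerKernel

/-! ## The dimension of the span of products of linear forms -/

section LinearAlgebra

variable {K V W ι : Type*} [DivisionRing K] [AddCommGroup V] [Module K V] [AddCommGroup W]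
  [Module K W]

theorem finrank_map_add_finrank_inf_ker (M : Submodule K V) [FiniteDimensional K M]
    (f : V →ₗ[K] W) :
    Module.finrank K (M.map f) + Module.finrank K (M ⊓ LinearMap.ker f : Submodule K V) =
      Module.finrank K M := by
  rw [← LinearMap.range_domRestrict, ← Submodule.map_comap_subtype, ← LinearMap.ker_domRestrict,
    Submodule.finrank_map_subtype_eq, LinearMap.finrank_range_add_finrank_ker]

theorem linearIndepOn_comp_iff {v : ι → V} {S : Set ι} {p : V →ₗ[K] W} :
    LinearIndepOn K (p ∘ v) S ↔
      LinearIndepOn K v S ∧ Disjoint (Submodule.span K (v '' S)) (LinearMap.ker p) := by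
  rw [Set.image_eq_range]
  exact ⟨fun h => ⟨h.of_comp p, Submodule.range_ker_disjoint (f := p) (v := fun j : S => v j) h⟩,
    fun h => LinearIndependent.map (f := p) h.1 h.2⟩

theorem linearIndepOn_insert_iff_comp {v : ι → V} {S : Set ι} {i : ι} {p : V →ₗ[K] W}
    (hp : LinearMap.ker p = Submodule.span K {v i}) (h0 : v i ≠ 0) (hi : i ∉ S) :
    LinearIndepOn K v (insert i S) ↔ LinearIndepOn K (p ∘ v) S := by
  rw [linearIndepOn_insert hi, linearIndepOn_comp_iff, hp, Submodule.disjoint_span_singleton' h0]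

end LinearAlgebra

section Dimension

variable {n : ℕ} {ι : Type*} {v : ι → Fin n → ℝ} {S : Finset ι} {i : ι}

instance finiteDimensional_prodSpan (v : ι → Fin n → ℝ) (S : Finset ι) :
    FiniteDimensional ℂ (prodSpan v S) :=
  FiniteDimensional.span_of_finite ℂ (S.powerset.finite_toSet.image _)

theorem shear_linForm_self {x w : Fin n → ℝ} (hw : w ⬝ᵥ x = 1) : shear x w (linForm x) = 0 := by
  rw [shear_linForm, projAlong_apply, hw, one_smul, sub_self, linForm_zero]

theorem prodSpan_insert_inf_ker_shear [DecidableEq ι] (hi : i ∉ S) (h0 : v i ≠ 0) {w : Fin n → ℝ}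
    (hw : w ⬝ᵥ v i = 1) :
    prodSpan v (insert i S) ⊓ LinearMap.ker (shear (v i) w).toLinearMap =
      (prodSpan v S).map (LinearMap.mulLeft ℂ (linForm (v i))) := by
  refine le_antisymm ?_ ?_
  · rintro f ⟨hf, hker⟩
    obtain ⟨q, rfl⟩ : linForm (v i) ∣ f := by
      have h := linForm_dvd_sub_shear (v i) w f
      rwa [show shear (v i) w f = 0 from hker, sub_zero] at h
    rw [SetLike.mem_coe, ← powerKer_eq_prodSpan] at hf
    exact ⟨q, powerKer_le_prodSpan v S (mem_powerKer_of_linForm_mul_mem_powerKer hi h0 hf), rfl⟩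
  · refine le_inf (prodSpan_insert v hi ▸ le_sup_right) ?_
    rintro _ ⟨q, -, rfl⟩
    simp [shear_linForm_self hw]

theorem map_shear_prodSpan_insert [DecidableEq ι] (hi : i ∉ S) {w : Fin n → ℝ}
    (hw : w ⬝ᵥ v i = 1) :
    (prodSpan v (insert i S)).map (shear (v i) w).toLinearMap =
      prodSpan (projAlong (v i) w ∘ v) S := by
  rw [prodSpan_insert v hi, Submodule.map_sup, map_shear_prodSpan, sup_eq_left]
  rintro _ ⟨_, ⟨q, -, rfl⟩, rfl⟩
  simp [shear_linForm_self hw]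

open Classical in
theorem finrank_prodSpan (v : ι → Fin n → ℝ) (S : Finset ι) :
    Module.finrank ℂ (prodSpan v S) =
      (S.powerset.filter fun I : Finset ι => LinearIndepOn ℝ v (I : Set ι)).card := by
  induction S using Finset.induction_on generalizing v with
  | empty =>
    rw [prodSpan_empty, finrank_span_singleton one_ne_zero, Finset.powerset_empty,
      Finset.filter_singleton, if_pos (by simp), Finset.card_singleton]
  | insert i S hi ih =>
    rw [Finset.card_filter, Finset.sum_powerset_insert hi, ← Finset.card_filter, ← ih v]
    simp only [Finset.coe_insert]
    rcases eq_or_ne (v i) 0 with h0 | h0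
    · rw [prodSpan_insert v hi, h0, linForm_zero, LinearMap.mulLeft_zero_eq_zero,
        Submodule.map_zero, sup_bot_eq, Finset.sum_eq_zero, add_zero]
      exact fun I _ => if_neg fun h => h.ne_zero (Set.mem_insert i I) h0
    · obtain ⟨w, hw⟩ := exists_dotProduct_eq_one h0
      have hcontract : (∑ I ∈ S.powerset, if LinearIndepOn ℝ v (insert i (I : Set ι)) then 1 else 0)
          = Module.finrank ℂ (prodSpan (projAlong (v i) w ∘ v) S) := by
        rw [ih, Finset.card_filter]
        refine Finset.sum_congr rfl fun I hI => ?_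
        have hiI : i ∉ (I : Set ι) := fun h => hi (Finset.mem_powerset.mp hI h)
        simp only [linearIndepOn_insert_iff_comp (ker_projAlong hw) h0 hiI]
      have hmul : Function.Injective (LinearMap.mulLeft ℂ (linForm (v i))) :=
        mul_right_injective₀ (linForm_ne_zero h0)
      rw [hcontract, ← finrank_map_add_finrank_inf_ker _ (shear (v i) w).toLinearMap,
        prodSpan_insert_inf_ker_shear hi h0 hw,
        ← (Submodule.equivMapOfInjective _ hmul _).finrank_eq,
        map_shear_prodSpan_insert hi hw, add_comm]

end Dimension

/-! ## Greedy extension -/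

section Greedy

theorem image_sumElim_union {α β γ : Type*} (v : α → γ) (b : β → γ) (s : Set α) (t : Set β) :
    Sum.elim v b '' (Sum.inl '' s ∪ Sum.inr '' t) = v '' s ∪ b '' t := by
  rw [Set.image_union, Set.image_image, Set.image_image]
  rfl

variable {K V ι κ : Type*} [DivisionRing K] [AddCommGroup V] [Module K V] [LinearOrder κ]

/-- The indices of the members of the ordered family `b` that the greedy algorithm adds to `s`. -/
def greedyIndices (K : Type*) {V κ : Type*} [DivisionRing K] [AddCommGroup V] [Module K V]
    [LinearOrder κ] (b : κ → V) (s : Set V) : Set κ :=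
  {k | b k ∉ Submodule.span K (s ∪ b '' {j | j < k})}

theorem mem_span_union_greedyIndices [WellFoundedLT κ] (b : κ → V) (s : Set V) (k : κ) :
    b k ∈ Submodule.span K (s ∪ b '' greedyIndices K b s) := by
  induction k using WellFoundedLT.induction with
  | ind k ih =>
    by_cases hk : k ∈ greedyIndices K b s
    · exact Submodule.subset_span (Or.inr ⟨k, hk, rfl⟩)
    · refine Submodule.span_le.mpr ?_ (not_not.mp hk)
      rintro _ (hy | ⟨j, hj, rfl⟩)
      · exact Submodule.subset_span (Or.inl hy)
      · exact ih j hj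

theorem span_union_greedyIndices [WellFoundedLT κ] (b : Module.Basis κ K V) (s : Set V) :
    Submodule.span K (s ∪ b '' greedyIndices K b s) = ⊤ := by
  rw [eq_top_iff, ← b.span_eq, Submodule.span_le, Set.range_subset_iff]
  exact mem_span_union_greedyIndices b s

theorem linearIndepOn_sumElim_greedyIndices [Finite κ] {v : ι → V} (b : κ → V) {s : Set ι}
    (hs : LinearIndepOn K v s) :
    LinearIndepOn K (Sum.elim v b) (Sum.inl '' s ∪ Sum.inr '' greedyIndices K b (v '' s)) := by
  suffices h : ∀ t : Finset κ, (t : Set κ) ⊆ greedyIndices K b (v '' s) →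
      LinearIndepOn K (Sum.elim v b) (Sum.inl '' s ∪ Sum.inr '' (t : Set κ)) by
    simpa using h (Set.toFinite (greedyIndices K b (v '' s))).toFinset (by simp)
  intro t ht
  induction t using Finset.induction_on_max with
  | empty => simpa using LinearIndepOn.image_of_comp Sum.inl (Sum.elim v b) hs
  | insert k t hk ih =>
    rw [Finset.coe_insert, Set.insert_subset_iff] at ht
    rw [Finset.coe_insert, Set.image_insert_eq, Set.union_insert]
    refine (ih ht.2).insert fun h => ht.1 ?_
    rw [image_sumElim_union] at h
    exact Submodule.span_mono (Set.union_subset_union_right _ (Set.image_mono hk)) h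

end Greedy

section GreedyExt

variable {n : ℕ} {ι : Type*}

theorem coe_greedyExt (X : ι → Fin n → ℝ) (B₀ : Module.Basis (Fin n) ℝ (Fin n → ℝ))
    (I : Finset ι) : (greedyExt X B₀ I : Set (ι ⊕ Fin n)) =
      Sum.inl '' (I : Set ι) ∪ Sum.inr '' greedyIndices ℝ B₀ (X '' (I : Set ι)) := by
  ext (i | k) <;> simp [greedyExt, greedyIndices]

theorem span_greedyExt (X : ι → Fin n → ℝ) (B₀ : Module.Basis (Fin n) ℝ (Fin n → ℝ))
    (I : Finset ι) : Submodule.span ℝ (augmented X B₀ '' (greedyExt X B₀ I)) = ⊤ := by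
  rw [coe_greedyExt, augmented, image_sumElim_union, span_union_greedyIndices]

theorem exists_basis_greedyExt {X : ι → Fin n → ℝ} (B₀ : Module.Basis (Fin n) ℝ (Fin n → ℝ))
    {I : Finset ι} (hI : I ∈ indepSets X) :
    ∃ b : Module.Basis (greedyExt X B₀ I) ℝ (Fin n → ℝ), ∀ y, b y = augmented X B₀ y := by
  have hindep : LinearIndepOn ℝ (augmented X B₀) (greedyExt X B₀ I : Set (ι ⊕ Fin n)) := by
    rw [coe_greedyExt]
    exact linearIndepOn_sumElim_greedyIndices B₀ hI
  refine ⟨Module.Basis.mk hindep ?_, fun y => Module.Basis.mk_apply _ _ _⟩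
  rw [← span_greedyExt X B₀ I, Set.image_eq_range]

theorem card_greedyExt {X : ι → Fin n → ℝ} (B₀ : Module.Basis (Fin n) ℝ (Fin n → ℝ))
    {I : Finset ι} (hI : I ∈ indepSets X) : (greedyExt X B₀ I).card = n := by
  obtain ⟨b, -⟩ := exists_basis_greedyExt B₀ hI
  simpa using (Module.finrank_eq_card_basis b).symm

theorem greedyExt_injective (X : ι → Fin n → ℝ) (B₀ : Module.Basis (Fin n) ℝ (Fin n → ℝ)) :
    Function.Injective (greedyExt X B₀) := fun I I' h => by
  ext i
  simpa [greedyExt] using Finset.ext_iff.mp h (Sum.inl i)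

end GreedyExt

/-! ## Vertices of generic arrangements -/

section Generic

variable {n : ℕ}

theorem existsUnique_forall_dotProduct_eq {κ : Type*} (b : Module.Basis κ ℝ (Fin n → ℝ))
    (lam : κ → ℝ) : ∃! t : Fin n → ℝ, ∀ k, b k ⬝ᵥ t = lam k := by
  have h (t : Fin n → ℝ) : (∀ k, b k ⬝ᵥ t = lam k) ↔
      dotProductEquiv ℝ (Fin n) t = b.constr ℝ lam := by
    refine ⟨fun h => b.ext fun k => ?_, fun h k => ?_⟩
    · rw [b.constr_basis, dotProductEquiv_apply_apply, dotProduct_comm, h]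
    · rw [dotProduct_comm, ← dotProductEquiv_apply_apply, h, b.constr_basis]
  simpa only [h] using (dotProductEquiv ℝ (Fin n)).bijective.existsUnique (b.constr ℝ lam)

theorem IsGeneric.eq_of_card_eq {κ : Type*} {v : κ → Fin n → ℝ} {lam : κ → ℝ}
    (hlam : IsGeneric v lam) {S T : Finset κ} (hS : S.card = n) (hT : T.card = n) {t : Fin n → ℝ}
    (htS : ∀ y ∈ S, v y ⬝ᵥ t = lam y) (htT : ∀ y ∈ T, v y ⬝ᵥ t = lam y) : S = T := by
  classical
  refine (Finset.eq_of_subset_of_card_le (fun y hy => ?_) (hS.trans hT.symm).le).symm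
  by_contra hyS
  refine hlam (insert y S) (by rw [Finset.card_insert_of_notMem hyS, hS]) ⟨t, fun z hz => ?_⟩
  rcases Finset.mem_insert.mp hz with rfl | hz
  · exact htT z hy
  · exact htS z hz

theorem exists_isGeneric {κ : Type*} [Finite κ] (v : κ → Fin n → ℝ) : ∃ lam, IsGeneric v lam := by
  have := Fintype.ofFinite κ
  let A (S : Finset κ) : (Fin n → ℝ) →ₗ[ℝ] (S → ℝ) :=
    LinearMap.pi fun y => dotProductEquiv ℝ (Fin n) (v y)
  let solvable (S : {S : Finset κ // S.card = n + 1}) : Submodule ℝ (κ → ℝ) :=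
    (LinearMap.range (A S)).comap (LinearMap.funLeft ℝ ℝ Subtype.val)
  have hsolvable S : solvable S ≠ ⊤ := fun h => by
    have hres := LinearMap.funLeft_surjective_of_injective ℝ ℝ _
      (Subtype.val_injective (p := (· ∈ S.1)))
    have hrange := LinearMap.range_le_iff_comap.mpr h
    rw [LinearMap.range_eq_top.mpr hres, top_le_iff, LinearMap.range_eq_top] at hrange
    have hle := LinearMap.finrank_le_finrank_of_surjective hrange
    simp [S.2] at hle
  have hcover : ⋃ S, (solvable S : Set (κ → ℝ)) ≠ Set.univ := fun h =>
    have ⟨S, hS⟩ := Subspace.exists_eq_top_of_iUnion_eq_univ h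
    hsolvable S hS
  obtain ⟨lam, hlam⟩ := (Set.ne_univ_iff_exists_notMem _).mp hcover
  exact ⟨lam, fun S hS ⟨t, ht⟩ => hlam (Set.mem_iUnion.mpr
    ⟨⟨S, hS⟩, t, funext fun y => ht y y.2⟩)⟩

end Generic

/-! ## The external spaces and ideals -/

section External

variable {n : ℕ} {ι : Type*}

theorem PPlus_eq_prodSpan [Fintype ι] (X : ι → Fin n → ℝ) : PPlus X = prodSpan X Finset.univ := by
  simp [PPlus, prodSpan]

theorem finrank_PPlus [Finite ι] (X : ι → Fin n → ℝ) :
    Module.finrank ℂ (PPlus X) = (indepSets X).ncard := by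
  classical
  have := Fintype.ofFinite ι
  rw [PPlus_eq_prodSpan, finrank_prodSpan, ← Set.ncard_coe_finset, Finset.powerset_univ,
    Finset.coe_filter_univ]
  rfl

instance finiteDimensional_PPlus [Finite ι] (X : ι → Fin n → ℝ) :
    FiniteDimensional ℂ (PPlus X) :=
  FiniteDimensional.span_of_finite ℂ (Set.finite_range _)

theorem eq_top_of_one_mem_of_X_mul_mem {τ R : Type*} [CommSemiring R]
    {M : Submodule R (MvPolynomial τ R)} (h1 : 1 ∈ M) (hX : ∀ i, ∀ p ∈ M, X i * p ∈ M) :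
    M = ⊤ := by
  refine eq_top_iff.mpr fun p _ => ?_
  induction p using MvPolynomial.induction_on with
  | C a => simpa [smul_eq_C_mul] using M.smul_mem a h1
  | add p q hp hq => exact add_mem (hp trivial) (hq trivial)
  | mul_X p i hp => exact mul_comm p (X i) ▸ hX i p (hp trivial)

variable (X : ι → Fin n → ℝ) (B₀ : Module.Basis (Fin n) ℝ (Fin n → ℝ))

theorem disjSum_singleton_mem_externalLong {Y : Finset ι} {k : Fin n}
    (hk : k ∈ greedyIndices ℝ B₀ (X '' (Y : Set ι)ᶜ)) : Y.disjSum {k} ∈ externalLong X B₀ := by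
  rintro _ ⟨I, -, rfl⟩
  by_cases h : Disjoint I Y
  · refine ⟨Sum.inr k, by simp, ?_⟩
    simp only [greedyExt, Finset.inr_mem_disjSum, Finset.mem_filter, Finset.mem_univ, true_and]
    have hIY : (I : Set ι) ⊆ (Y : Set ι)ᶜ := fun i hI hY => Finset.disjoint_left.mp h hI hY
    exact fun hI => hk (Submodule.span_mono (Set.union_subset_union_left _ (Set.image_mono hIY)) hI)
  · obtain ⟨i, hI, hY⟩ := Finset.not_disjoint_iff.mp h
    exact ⟨Sum.inl i, by simpa using hY, by simpa [greedyExt] using hI⟩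

/- The vector `x` is a combination of members of `X` outside `Y`, which keep the product in `P₊`,
and of those `b ∈ B₀` that are greedily added to them, for which `Y ∪ {b}` is long. -/
theorem linForm_mul_prodForm_mem_sup (x : Fin n → ℝ) (Y : Finset ι) :
    linForm x * prodForm X Y ∈ PPlus X ⊔ (JPlus X B₀).restrictScalars ℂ := by
  classical
  let M := (PPlus X ⊔ (JPlus X B₀).restrictScalars ℂ).restrictScalars ℝ
  suffices h : Submodule.span ℝ (X '' (Y : Set ι)ᶜ ∪ B₀ '' greedyIndices ℝ B₀ (X '' (Y : Set ι)ᶜ)) ≤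
      M.comap (LinearMap.mulRight ℝ (prodForm X Y) ∘ₗ linFormMap n) by
    rw [span_union_greedyIndices] at h
    exact h (Submodule.mem_top (x := x))
  rw [Submodule.span_le]
  rintro _ (⟨j, hj, rfl⟩ | ⟨k, hk, rfl⟩)
  · exact Submodule.mem_sup_left (Submodule.subset_span ⟨insert j Y, prodForm_insert hj⟩)
  · refine Submodule.mem_sup_right (Ideal.subset_span
      ⟨_, disjSum_singleton_mem_externalLong X B₀ hk, ?_⟩)
    simp [prodForm, augmented, linFormMap_apply, Finset.prod_disjSum, mul_comm]

theorem PPlus_sup_JPlus : PPlus X ⊔ (JPlus X B₀).restrictScalars ℂ = ⊤ := by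
  refine eq_top_of_one_mem_of_X_mul_mem
    (Submodule.mem_sup_left (Submodule.subset_span ⟨∅, Finset.prod_empty⟩)) fun i p hp => ?_
  suffices h : PPlus X ⊔ (JPlus X B₀).restrictScalars ℂ ≤
      (PPlus X ⊔ (JPlus X B₀).restrictScalars ℂ).comap (LinearMap.mulLeft ℂ (MvPolynomial.X i)) from
    h hp
  refine sup_le (Submodule.span_le.mpr ?_) fun q hq =>
    Submodule.mem_sup_right (Ideal.mul_mem_left (JPlus X B₀) _ hq)
  rintro _ ⟨Y, rfl⟩
  simpa [linForm_single] using linForm_mul_prodForm_mem_sup X B₀ (Pi.single i 1) Y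

theorem forall_mem_span_pairing_eq_zero {G : Set (Poly n)} {f : Series n} :
    (∀ q ∈ Ideal.span G, pairing q f = 0) ↔ ∀ g ∈ G, diffOp n g f = 0 := by
  refine ⟨fun h g hg => eq_zero_of_forall_pairing_monomial fun m => ?_, fun h q hq => ?_⟩
  · rw [← pairing_mul]
    exact h _ (Ideal.mul_mem_left _ _ (Ideal.subset_span hg))
  · suffices diffOp n q f = 0 by rw [pairing, LinearMap.comp_apply, this, map_zero]
    induction hq using Submodule.span_induction with
    | mem q hq => exact h q hq
    | zero => rw [map_zero, LinearMap.zero_apply]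
    | add p q _ _ hp hq => rw [map_add, LinearMap.add_apply, hp, hq, add_zero]
    | smul a q _ hq => rw [smul_eq_mul, diffOp_mul, Module.End.mul_apply, hq, map_zero]

variable {X B₀}

theorem mem_DPlus {f : Poly n} : f ∈ DPlus X B₀ ↔
    ∀ Y ∈ externalLong X B₀, diffOp n (prodForm (augmented X B₀) Y) (toSeries n f) = 0 := by
  simp [DPlus]

theorem mem_DPlus_iff_forall_mem_JPlus {f : Poly n} :
    f ∈ DPlus X B₀ ↔ ∀ q ∈ JPlus X B₀, pairing q (toSeries n f) = 0 := by
  rw [JPlus, forall_mem_span_pairing_eq_zero, Set.forall_mem_image, mem_DPlus]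

theorem eq_zero_of_mem_DPlus {f : Poly n} (hf : f ∈ DPlus X B₀)
    (h : ∀ p ∈ PPlus X, pairing p (toSeries n f) = 0) : f = 0 := by
  suffices hker : PPlus X ⊔ (JPlus X B₀).restrictScalars ℂ ≤
      LinearMap.ker ((pairingBilin n).flip (toSeries n f)) by
    rw [PPlus_sup_JPlus, top_le_iff, LinearMap.ker_eq_top] at hker
    refine toSeries_injective n ((eq_zero_of_forall_pairing_monomial fun m => ?_).trans
      (map_zero _).symm)
    exact LinearMap.congr_fun hker _
  exact sup_le h fun q hq => mem_DPlus_iff_forall_mem_JPlus.mp hf q hq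

/-! ## Duality and vertices -/

/-- `pairingMap D P` as a linear map. -/
def pairingLinear (D P : Submodule ℂ (Poly n)) : D →ₗ[ℂ] Module.Dual ℂ P :=
  ((pairingBilin n).compl₂ (toSeries n)).domRestrict₁₂ D P

theorem coe_pairingLinear (D P : Submodule ℂ (Poly n)) :
    ⇑(pairingLinear D P) = pairingMap D P := rfl

variable (X B₀)

theorem pairingLinear_injective : Function.Injective (pairingLinear (DPlus X B₀) (PPlus X)) :=
  LinearMap.ker_eq_bot.mp <| LinearMap.ker_eq_bot'.mpr fun f hf =>
    Subtype.ext <| eq_zero_of_mem_DPlus f.2 fun p hp =>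
      (pairing_toSeries_comm p f).trans (LinearMap.congr_fun hf ⟨p, hp⟩)

instance finiteDimensional_DPlus [Finite ι] : FiniteDimensional ℂ (DPlus X B₀) :=
  FiniteDimensional.of_injective _ (pairingLinear_injective X B₀)

theorem finrank_DPlus_le [Finite ι] :
    Module.finrank ℂ (DPlus X B₀) ≤ Module.finrank ℂ (PPlus X) :=
  (LinearMap.finrank_le_finrank_of_injective (pairingLinear_injective X B₀)).trans_eq
    Subspace.dual_finrank_eq

theorem eval_linForm (x : Fin n → ℝ) (α : Fin n → ℂ) :
    eval α (linForm x) = ∑ i, (x i : ℂ) * α i := by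
  simp [linForm]

theorem totalDegree_linForm_sub_C_le (x : Fin n → ℝ) (c : ℂ) :
    (linForm x - C c).totalDegree ≤ 1 :=
  (totalDegree_sub _ _).trans (max_le (isHomogeneous_linForm x).totalDegree_le (by simp))

theorem homogeneousComponent_one_linForm_sub_C (x : Fin n → ℝ) (c : ℂ) :
    homogeneousComponent 1 (linForm x - C c) = linForm x := by
  rw [map_sub, homogeneousComponent_of_mem (isHomogeneous_linForm x), if_pos rfl,
    homogeneousComponent_of_mem (isHomogeneous_C _ c), if_neg one_ne_zero, sub_zero]

variable {X B₀} {lam : ι ⊕ Fin n → ℝ}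

theorem exists_eval_eq_zero_of_mem_externalLong {Y : Finset (ι ⊕ Fin n)}
    (hY : Y ∈ externalLong X B₀) {α : Fin n → ℂ} (hα : α ∈ externalVertices X B₀ lam) :
    ∃ y ∈ Y, eval α (linForm (augmented X B₀ y) - C (lam y : ℂ)) = 0 := by
  obtain ⟨t, ⟨B, hB, ht⟩, rfl⟩ := hα
  obtain ⟨y, hyY, hyB⟩ := hY B hB
  refine ⟨y, hyY, ?_⟩
  rw [map_sub, eval_linForm, eval_C, ← ht y hyB, dotProduct]
  push_cast
  exact sub_self _

/- `∏ (p_y - lam_y)`, `y ∈ Y`, vanishes on the vertices and its leading form is `p_Y`. -/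
theorem leastSpace_externalVertices_le_DPlus (X : ι → Fin n → ℝ)
    (B₀ : Module.Basis (Fin n) ℝ (Fin n → ℝ)) (lam : ι ⊕ Fin n → ℝ) :
    leastSpace (externalVertices X B₀ lam) ≤ DPlus X B₀ := by
  refine fun f hf => mem_DPlus.mpr fun Y hY => eq_zero_of_forall_pairing_monomial fun m => ?_
  let a : Poly n := monomial m 1
  let q : Poly n := ∏ y ∈ Y, (linForm (augmented X B₀ y) - C (lam y : ℂ))
  have ha : a.IsHomogeneous m.degree := isHomogeneous_monomial 1 rfl
  have hfactor : ∀ y ∈ Y, (linForm (augmented X B₀ y) - C (lam y : ℂ)).totalDegree ≤ 1 :=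
    fun y _ => totalDegree_linForm_sub_C_le _ _
  have hq : q.totalDegree ≤ ∑ _y ∈ Y, 1 :=
    (totalDegree_finsetProd Y _).trans (Finset.sum_le_sum hfactor)
  have hlead : homogeneousComponent (m.degree + ∑ _y ∈ Y, 1) (a * q) =
      a * prodForm (augmented X B₀) Y := by
    rw [homogeneousComponent_add_mul ha.totalDegree_le hq, homogeneousComponent_prod Y hfactor,
      homogeneousComponent_of_mem ha, if_pos rfl]
    simp only [homogeneousComponent_one_linForm_sub_C, prodForm]
  rw [← pairing_mul, ← hlead]
  refine pairing_leastSpace_eq_zero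
    ((totalDegree_mul _ _).trans (add_le_add ha.totalDegree_le hq)) (fun α hα => ?_) hf
  obtain ⟨y, hy, hy0⟩ := exists_eval_eq_zero_of_mem_externalLong hY hα
  rw [map_mul, map_prod, Finset.prod_eq_zero hy hy0, mul_zero]

end External

section Vertices

variable {n : ℕ} {ι : Type*} (X : ι → Fin n → ℝ) (B₀ : Module.Basis (Fin n) ℝ (Fin n → ℝ))
  (lam : ι ⊕ Fin n → ℝ)

theorem existsUnique_vertex {I : Finset ι} (hI : I ∈ indepSets X) :
    ∃! t : Fin n → ℝ, ∀ y ∈ greedyExt X B₀ I, augmented X B₀ y ⬝ᵥ t = lam y := by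
  obtain ⟨b, hb⟩ := exists_basis_greedyExt B₀ hI
  simpa [hb] using existsUnique_forall_dotProduct_eq b fun y => lam y

theorem exists_externalVertices_eq_range : ∃ t : indepSets X → Fin n → ℝ,
    (∀ I : indepSets X, ∀ y ∈ greedyExt X B₀ I, augmented X B₀ y ⬝ᵥ t I = lam y) ∧
      externalVertices X B₀ lam = Set.range fun (I : indepSets X) i => (t I i : ℂ) := by
  choose t ht huniq using fun I : indepSets X => existsUnique_vertex X B₀ lam I.2
  refine ⟨t, ht, Set.Subset.antisymm ?_ ?_⟩
  · rintro _ ⟨s, ⟨_, ⟨I, hI, rfl⟩, hs⟩, rfl⟩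
    exact ⟨⟨I, hI⟩, by rw [huniq ⟨I, hI⟩ s hs]⟩
  · rintro _ ⟨I, rfl⟩
    exact ⟨t I, ⟨_, ⟨I, I.2, rfl⟩, ht I⟩, rfl⟩

instance finite_externalVertices [Finite ι] : Finite (externalVertices X B₀ lam) := by
  obtain ⟨t, -, ht⟩ := exists_externalVertices_eq_range X B₀ lam
  exact ht ▸ (Set.finite_range _).to_subtype

variable {X B₀ lam}

theorem star_mem_externalVertices {α : Fin n → ℂ} (hα : α ∈ externalVertices X B₀ lam) :
    star α ∈ externalVertices X B₀ lam := by
  obtain ⟨t, ht, rfl⟩ := hα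
  exact ⟨t, ht, funext fun i => (Complex.conj_ofReal (t i)).symm⟩

theorem card_externalVertices (hlam : IsGeneric (augmented X B₀) lam) :
    Nat.card (externalVertices X B₀ lam) = (indepSets X).ncard := by
  obtain ⟨t, ht, heq⟩ := exists_externalVertices_eq_range X B₀ lam
  rw [heq, Nat.card_range_of_injective, Nat.card_coe_set_eq]
  intro I I' h
  have htt : t I = t I' := funext fun i => Complex.ofReal_injective (congrFun h i)
  exact Subtype.ext (greedyExt_injective X B₀ (hlam.eq_of_card_eq (card_greedyExt B₀ I.2)
    (card_greedyExt B₀ I'.2) (ht I) (htt ▸ ht I')))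

theorem leastSpace_externalVertices [Finite ι] (hlam : IsGeneric (augmented X B₀) lam) :
    leastSpace (externalVertices X B₀ lam) = DPlus X B₀ := by
  refine Submodule.eq_of_le_of_finrank_le (leastSpace_externalVertices_le_DPlus X B₀ lam) ?_
  rw [finrank_leastSpace fun _ => star_mem_externalVertices, card_externalVertices hlam,
    ← finrank_PPlus]
  exact finrank_DPlus_le X B₀

variable (X B₀)

theorem finrank_DPlus [Finite ι] : Module.finrank ℂ (DPlus X B₀) = (indepSets X).ncard := by
  obtain ⟨lam, hlam⟩ := exists_isGeneric (augmented X B₀)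
  rw [← leastSpace_externalVertices hlam, finrank_leastSpace fun _ => star_mem_externalVertices,
    card_externalVertices hlam]

theorem pairingMap_bijective [Finite ι] :
    Function.Bijective (pairingMap (DPlus X B₀) (PPlus X)) := by
  rw [← coe_pairingLinear]
  have hinj := pairingLinear_injective X B₀
  refine ⟨hinj, (LinearMap.injective_iff_surjective_of_finrank_eq_finrank ?_).mp hinj⟩
  rw [Subspace.dual_finrank_eq, finrank_PPlus, finrank_DPlus]

variable {X}

theorem eq_zero_of_mem_PPlus [Finite ι] {p : Poly n} (hp : p ∈ PPlus X)
    (h : ∀ f ∈ DPlus X B₀, pairing p (toSeries n f) = 0) : p = 0 := by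
  suffices h0 : (⟨p, hp⟩ : PPlus X) = 0 from congrArg Subtype.val h0
  refine (Module.forall_dual_apply_eq_zero_iff ℂ _).mp fun φ => ?_
  obtain ⟨f, rfl⟩ := (pairingMap_bijective X B₀).2 φ
  exact (pairing_toSeries_comm _ _).trans (h f f.2)

theorem homogeneousComponent_mem_PPlus {p : Poly n} (hp : p ∈ PPlus X) (k : ℕ) :
    homogeneousComponent k p ∈ PPlus X :=
  homogeneousComponent_mem_span (Set.forall_mem_range.mpr fun Y =>
    ⟨_, IsHomogeneous.prod Y _ _ fun y _ => isHomogeneous_linForm (X y)⟩) hp k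

theorem isCompl_PPlus_JPlus [Finite ι] (X : ι → Fin n → ℝ) :
    IsCompl (PPlus X) ((JPlus X B₀).restrictScalars ℂ) :=
  ⟨Submodule.disjoint_def.mpr fun p hp hJ => eq_zero_of_mem_PPlus B₀ hp fun _ hf =>
    mem_DPlus_iff_forall_mem_JPlus.mp hf p hJ, codisjoint_iff.mpr (PPlus_sup_JPlus X B₀)⟩

variable {B₀}

theorem isCorrect_DPlus [Finite ι] (hlam : IsGeneric (augmented X B₀) lam) :
    IsCorrect (externalVertices X B₀ lam) (DPlus X B₀) :=
  leastSpace_externalVertices hlam ▸ isCorrect_leastSpace fun _ => star_mem_externalVertices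

theorem isCorrect_PPlus [Finite ι] (hlam : IsGeneric (augmented X B₀) lam) :
    IsCorrect (externalVertices X B₀ lam) (PPlus X) := by
  refine isCorrect_of_finrank_eq_card (fun _ => eq_zero_of_eval_eq_zero
    (fun _ => homogeneousComponent_mem_PPlus) fun p hp hperp => eq_zero_of_mem_PPlus B₀ hp ?_)
    ((finrank_PPlus X).trans (card_externalVertices hlam).symm)
  rwa [← leastSpace_externalVertices hlam]

end Vertices

/-! ## Kernels of ideals with the origin as only common zero -/

section IdealKer

variable {n : ℕ} {ι : Type*}

theorem map_toSeries_eq_idealKer {I : Ideal (Poly n)} {M : Submodule ℂ (Poly n)}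
    (hI : ∀ α : Fin n → ℂ, (∀ q ∈ I, eval α q = 0) ↔ α = 0)
    (hM : ∀ f, f ∈ M ↔ ∀ q ∈ I, pairing q (toSeries n f) = 0) :
    M.map (toSeries n) = idealKer I := by
  refine le_antisymm ?_ (Submodule.span_le.mpr ?_)
  · rintro _ ⟨f, hf, rfl⟩
    refine Submodule.subset_span ⟨0, (hI 0).mpr rfl, f, ?_, (hM f).mp hf⟩
    rw [expSeries_zero, one_mul]
  · rintro _ ⟨α, hα, p, rfl, hp⟩
    obtain rfl := (hI α).mp hα
    rw [expSeries_zero, one_mul] at hp ⊢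
    exact ⟨p, (hM p).mpr hp, rfl⟩

theorem forall_mem_span_eval_eq_zero {G : Set (Poly n)} {α : Fin n → ℂ} :
    (∀ q ∈ Ideal.span G, eval α q = 0) ↔ ∀ g ∈ G, eval α g = 0 :=
  Ideal.span_le (I := RingHom.ker (eval α))

theorem eval_zero_linForm (x : Fin n → ℝ) : eval 0 (linForm x) = 0 := by
  rw [eval_linForm]
  simp

theorem eq_zero_of_eval_linForm_eq_zero {s : Set (Fin n → ℝ)} (hs : Submodule.span ℝ s = ⊤)
    {α : Fin n → ℂ} (h : ∀ x ∈ s, eval α (linForm x) = 0) : α = 0 := by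
  have hle : Submodule.span ℝ s ≤
      LinearMap.ker ((aeval α).toLinearMap.restrictScalars ℝ ∘ₗ linFormMap n) :=
    Submodule.span_le.mpr h
  rw [hs] at hle
  refine funext fun i => ?_
  have hi : eval α (linForm (Pi.single i 1)) = 0 := hle (Submodule.mem_top (x := Pi.single i 1))
  rwa [linForm_single, eval_X] at hi

theorem forall_mem_JPlus_eval_eq_zero_iff [Finite ι] {X : ι → Fin n → ℝ}
    {B₀ : Module.Basis (Fin n) ℝ (Fin n → ℝ)} {α : Fin n → ℂ} :
    (∀ q ∈ JPlus X B₀, eval α q = 0) ↔ α = 0 := by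
  classical
  have := Fintype.ofFinite ι
  rw [JPlus, forall_mem_span_eval_eq_zero, Set.forall_mem_image]
  refine ⟨fun h => ?_, ?_⟩
  · by_contra hα
    let Y : Finset (ι ⊕ Fin n) := {y | eval α (linForm (augmented X B₀ y)) ≠ 0}
    have hY : Y ∈ externalLong X B₀ := by
      rintro _ ⟨I, -, rfl⟩
      by_contra! hdisj
      refine hα (eq_zero_of_eval_linForm_eq_zero (span_greedyExt X B₀ I) ?_)
      rintro _ ⟨y, hy, rfl⟩
      by_contra hy0
      exact hdisj y (by simpa [Y] using hy0) hy
    have hprod := h hY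
    rw [prodForm, map_prod, Finset.prod_eq_zero_iff] at hprod
    obtain ⟨y, hy, hy0⟩ := hprod
    exact (Finset.mem_filter.mp hy).2 hy0
  · rintro rfl Y hY
    obtain ⟨y, hy, -⟩ := hY _ ⟨∅, by simp [indepSets], rfl⟩
    rw [prodForm, map_prod, Finset.prod_eq_zero hy (eval_zero_linForm _)]

theorem map_DPlus_eq_idealKer [Finite ι] (X : ι → Fin n → ℝ)
    (B₀ : Module.Basis (Fin n) ℝ (Fin n → ℝ)) :
    (DPlus X B₀).map (toSeries n) = idealKer (JPlus X B₀) :=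
  map_toSeries_eq_idealKer (fun _ => forall_mem_JPlus_eval_eq_zero_iff)
    fun _ => mem_DPlus_iff_forall_mem_JPlus

end IdealKer

/-! ## The power ideal of the facet hyperplanes -/

section Facets

variable {n : ℕ} {ι : Type*} {X : ι → Fin n → ℝ}

/-- The nonzero normals of the facet hyperplanes of `X`. -/
def facetNormals (X : ι → Fin n → ℝ) : Set (Fin n → ℝ) :=
  {η | η ≠ 0 ∧ IsFlatFunctional X Set.univ (dotProductEquiv ℝ (Fin n) η)}

theorem finrank_ker_dotProductEquiv_add_one {η : Fin n → ℝ} (hη : η ≠ 0) :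
    Module.finrank ℝ (LinearMap.ker (dotProductEquiv ℝ (Fin n) η)) + 1 = n := by
  rw [Module.Dual.finrank_ker_add_one_of_ne_zero ((LinearEquiv.map_ne_zero_iff _).mpr hη),
    Module.finrank_fin_fun]

theorem ker_mem_facetHyperplanes_iff (hX : Submodule.span ℝ (Set.range X) = ⊤) {η : Fin n → ℝ}
    (hη : η ≠ 0) : LinearMap.ker (dotProductEquiv ℝ (Fin n) η) ∈ facetHyperplanes X ↔
      IsFlatFunctional X Set.univ (dotProductEquiv ℝ (Fin n) η) := by
  have himage : Set.range X ∩ LinearMap.ker (dotProductEquiv ℝ (Fin n) η) =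
      X '' {i ∈ Set.univ | dotProductEquiv ℝ (Fin n) η (X i) = 0} := by
    ext x
    constructor
    · rintro ⟨⟨i, rfl⟩, hi⟩
      exact ⟨i, ⟨trivial, hi⟩, rfl⟩
    · rintro ⟨i, ⟨-, hi⟩, rfl⟩
      exact ⟨⟨i, rfl⟩, hi⟩
  rw [IsFlatFunctional, Set.image_univ, hX, top_inf_eq, ← himage]
  exact ⟨fun h => h.2.ge, fun h => ⟨finrank_ker_dotProductEquiv_add_one hη,
    le_antisymm (Submodule.span_le.mpr Set.inter_subset_right) h⟩⟩

theorem eq_ker_of_forall_dotProduct_eq_zero {H : Submodule ℝ (Fin n → ℝ)} {η : Fin n → ℝ}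
    (hH : Module.finrank ℝ H + 1 = n) (hη : η ≠ 0) (h : ∀ x ∈ H, η ⬝ᵥ x = 0) :
    H = LinearMap.ker (dotProductEquiv ℝ (Fin n) η) :=
  Submodule.eq_of_le_of_finrank_eq h
    (Nat.succ_injective (hH.trans (finrank_ker_dotProductEquiv_add_one hη).symm))

theorem outsideCount_ker [Fintype ι] (X : ι → Fin n → ℝ) (η : Fin n → ℝ) :
    outsideCount X (LinearMap.ker (dotProductEquiv ℝ (Fin n) η)) =
      nonOrthCount X Finset.univ η := by
  rw [nonOrthCount, ← Set.ncard_coe_finset, Finset.coe_filter_univ]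
  rfl

theorem IPlus_eq_span [Fintype ι] (hX : Submodule.span ℝ (Set.range X) = ⊤) :
    IPlus X = Ideal.span
      ((fun η => linForm η ^ (nonOrthCount X Finset.univ η + 1)) '' facetNormals X) := by
  refine congrArg Ideal.span (Set.Subset.antisymm ?_ ?_)
  · rintro _ ⟨H, hH, η, hη, horth, rfl⟩
    obtain rfl := eq_ker_of_forall_dotProduct_eq_zero hH.1 hη horth
    exact ⟨η, ⟨hη, (ker_mem_facetHyperplanes_iff hX hη).mp hH⟩, by rw [outsideCount_ker]⟩
  · rintro _ ⟨η, ⟨hη, hflat⟩, rfl⟩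
    exact ⟨_, (ker_mem_facetHyperplanes_iff hX hη).mpr hflat, η, hη, fun _ => id,
      by rw [outsideCount_ker]⟩

theorem mem_PPlus_iff_forall_mem_IPlus [Finite ι] (hX : Submodule.span ℝ (Set.range X) = ⊤)
    {f : Poly n} : f ∈ PPlus X ↔ ∀ q ∈ IPlus X, pairing q (toSeries n f) = 0 := by
  have := Fintype.ofFinite ι
  rw [IPlus_eq_span hX, forall_mem_span_pairing_eq_zero, Set.forall_mem_image, PPlus_eq_prodSpan,
    ← powerKer_eq_prodSpan, mem_powerKer, Finset.coe_univ]
  simp only [diffOp_linForm_pow_toSeries, map_eq_zero_iff _ (toSeries_injective n)]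
  refine ⟨fun h η hη => h η hη.2, fun h η hη => ?_⟩
  rcases eq_or_ne η 0 with rfl | h0
  · have hdir : dirDeriv 0 f = 0 := by simp [dirDeriv]
    rw [Function.iterate_succ_apply, hdir, iterate_map_zero]
  · exact h ⟨h0, hη⟩

theorem span_facetNormals (hX : Submodule.span ℝ (Set.range X) = ⊤) :
    Submodule.span ℝ (facetNormals X) = ⊤ := by
  classical
  let b := Module.Basis.ofSpan hX.ge
  have := Module.Finite.finite_basis b
  let b' := b.dualBasis.map (dotProductEquiv ℝ (Fin n)).symm
  rw [eq_top_iff, ← b'.span_eq]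
  refine Submodule.span_mono (Set.range_subset_iff.mpr fun j => ⟨b'.ne_zero j, ?_⟩)
  have hcoord : dotProductEquiv ℝ (Fin n) (b' j) = b.coord j := by simp [b']
  rw [hcoord]
  exact isFlatFunctional_coord b (Set.image_univ.symm ▸ Module.Basis.ofSpan_subset hX.ge) j

theorem forall_mem_IPlus_eval_eq_zero_iff [Finite ι] (hX : Submodule.span ℝ (Set.range X) = ⊤)
    {α : Fin n → ℂ} : (∀ q ∈ IPlus X, eval α q = 0) ↔ α = 0 := by
  have := Fintype.ofFinite ι
  rw [IPlus_eq_span hX, forall_mem_span_eval_eq_zero, Set.forall_mem_image]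
  simp only [map_pow, pow_eq_zero_iff (Nat.succ_ne_zero _)]
  refine ⟨eq_zero_of_eval_linForm_eq_zero (span_facetNormals hX), ?_⟩
  rintro rfl η -
  exact eval_zero_linForm η

theorem map_PPlus_eq_idealKer [Finite ι] (hX : Submodule.span ℝ (Set.range X) = ⊤) :
    (PPlus X).map (toSeries n) = idealKer (IPlus X) :=
  map_toSeries_eq_idealKer (fun _ => forall_mem_IPlus_eval_eq_zero_iff hX)
    fun _ => mem_PPlus_iff_forall_mem_IPlus hX

end Facets

end

end Zonotopal

theorem mainTheorem1_general {n : ℕ} {ι : Type*} [Finite ι] (X : ι → Fin n → ℝ)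
    (B₀ : Module.Basis (Fin n) ℝ (Fin n → ℝ)) :
    (Module.finrank ℂ (PPlus X) = (indepSets X).ncard ∧
      Module.finrank ℂ (DPlus X B₀) = (indepSets X).ncard) ∧
    Function.Bijective (pairingMap (DPlus X B₀) (PPlus X)) ∧
    ((∀ lam : ι ⊕ Fin n → ℝ, IsGeneric (augmented X B₀) lam →
        DPlus X B₀ = leastSpace (externalVertices X B₀ lam)) ∧
      (DPlus X B₀).map (toSeries n) = idealKer (JPlus X B₀)) ∧
    (∀ lam : ι ⊕ Fin n → ℝ, IsGeneric (augmented X B₀) lam →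
      IsCorrect (externalVertices X B₀ lam) (DPlus X B₀) ∧
      IsCorrect (externalVertices X B₀ lam) (PPlus X)) ∧
    (Submodule.span ℝ (Set.range X) = ⊤ →
      (PPlus X).map (toSeries n) = idealKer (IPlus X)) ∧
    IsCompl (PPlus X) ((JPlus X B₀).restrictScalars ℂ) :=
  ⟨⟨finrank_PPlus X, finrank_DPlus X B₀⟩, pairingMap_bijective X B₀,
    ⟨fun _ hlam => (leastSpace_externalVertices hlam).symm, map_DPlus_eq_idealKer X B₀⟩,
    fun _ hlam => ⟨isCorrect_DPlus hlam, isCorrect_PPlus hlam⟩,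
    map_PPlus_eq_idealKer, isCompl_PPlus_JPlus B₀ X⟩

theorem mainTheorem1 {n : ℕ} {ι : Type*} [Finite ι] (X : ι → Fin n → ℝ)
    (hX0 : ∀ i, X i ≠ 0) (hX : Submodule.span ℝ (Set.range X) = ⊤)
    (B₀ : Module.Basis (Fin n) ℝ (Fin n → ℝ)) :
    (Module.finrank ℂ (PPlus X) = (indepSets X).ncard ∧
      Module.finrank ℂ (DPlus X B₀) = (indepSets X).ncard) ∧
    Function.Bijective (pairingMap (DPlus X B₀) (PPlus X)) ∧
    ((∀ lam : ι ⊕ Fin n → ℝ, IsGeneric (augmented X B₀) lam →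
        DPlus X B₀ = leastSpace (externalVertices X B₀ lam)) ∧
      (DPlus X B₀).map (toSeries n) = idealKer (JPlus X B₀)) ∧
    (∀ lam : ι ⊕ Fin n → ℝ, IsGeneric (augmented X B₀) lam →
      IsCorrect (externalVertices X B₀ lam) (DPlus X B₀) ∧
      IsCorrect (externalVertices X B₀ lam) (PPlus X)) ∧
    (PPlus X).map (toSeries n) = idealKer (IPlus X) ∧
    IsCompl (PPlus X) ((JPlus X B₀).restrictScalars ℂ) := by
  obtain ⟨hdim, hpairing, hD, hcorrect, hP, hcompl⟩ := mainTheorem1_general X B₀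
  exact ⟨hdim, hpairing, hD, hcorrect, hP hX, hcompl⟩
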